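/- **Setting.** Let $d,N,p\ge 1$ and $T\ge 3$. A network of $N$ units has directed graphs $(\{1,\dots,N\},\mathcal E_t)$, weight matrices $\mathbf A(t)$ ($t\ge 1$), losses $\ell_{i,t}:\mathbb R^d\to\mathbb R$ ($1\le i\le N$, $1\le t\le T$) and constraint functions $c_1,\dots,c_p:\mathbb R^d\to\mathbb R$. Put $\mathcal X=\{\mathbf x: c_s(\mathbf x)\le 0,\ s=1,\dots,p\}$, $\mathcal B=\{\mathbf x:\|\mathbf x\|\le R\}$, $[a]_+=\max\{0,a\}$. Assume: 1. $R>0$, $\mathcal X\subseteq\mathcal B$ and $\mathbf 0\in\mathcal X$. 2. All $\ell_{i,t}$ and $c_s$ are convex on $\mathbb R^d$ and differentiable at the points of $\mathcal B$, with $\|\nabla\ell_{i,t}\|\le G_\ell$ and $\|\nabla c_s\|\le G_c$ on $\mathcal B$; $G=\max\{G_\ell,G_c\}$. 3. For some integer $B\ge 1$, the graph with edge set $\mathcal E_{kB+1}\cup\dots\cup\mathcal E_{(k+1)B}$ is strongly connected for every $k\ge 0$. 4. Every $\mathbf A(t)$ is doubly stochastic, and for some $\zeta>0$: $[\mathbf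 A(t)]_{ii}\ge\zeta$; $[\mathbf A(t)]_{ij}\ge\zeta$ if $(j,i)\in\mathcal E_t$; and $[\mathbf A(t)]_{ij}=0$ if $i\ne j$ and $(j,i)\notin\mathcal E_t$. 5. For some $\sigma>0$, $\ell_{i,t}(\mathbf x)\ge\ell_{i,t}(\mathbf y)+\nabla\ell_{i,t}(\mathbf y)^{\mathsf T}(\mathbf x-\mathbf y)+\frac\sigma2\|\mathbf x-\mathbf y\|^2$ for all $\mathbf x,\mathbf y\in\mathcal B$. 6. $|\ell_{i,t}(\mathbf x)|\le C$ for all $\mathbf x\in\mathcal B$ and all $i,t$. **Algorithm** (DOCO-LTC with one-point bandit feedback). Let $$\eta_t=\frac{2pG^2}{\sigma t},\quad \beta_t=\frac1{\sigma t},\quad \varepsilon_t=\frac1{T^{1/3}},\quad \pi=\frac1{R\,T^{1/3}},$$ and assume $\pi\le 1$. Let $\mathbf u_i(t)$ ($1\le i\le N$, $1\le t\le T$) be independent and uniformly distributed on the unit sphere of $\mathbb R^d$. Start from $\mathbf x_i(1)=\mathbf 0\in\mathbb R^d$, $\boldsymbol\lambda_i(1)=\mathbf 0\in\mathbb R^p$.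 In round $t$, with $\partial[c_s(\mathbf x)]_+$ equal to $\nabla c_s(\mathbf x)$ if $c_s(\mathbf x)>0$ and to $\mathbf 0$ otherwise, compute $$\mathbf y_i(t)=\mathbf x_i(t)-\beta_t\Big[\frac d{\varepsilon_t}\,\ell_{i,t}\big(\mathbf x_i(t)+\varepsilon_t\mathbf u_i(t)\big)\mathbf u_i(t)+\sum_{s=1}^p[\boldsymbol\lambda_i(t)]_s\,\partial[c_s(\mathbf x_i(t))]_+\Big],$$ $$\mathbf x_i(t+1)=\Pi_{(1-\pi)\mathcal B}\Big(\sum_{j=1}^N[\mathbf A(t)]_{ij}\,\mathbf y_j(t)\Big),\qquad [\boldsymbol\lambda_i(t+1)]_s=\frac{[c_s(\mathbf x_i(t+1))]_+}{\eta_t},$$ where $\Pi_{(1-\pi)\mathcal B}$ is the Euclidean projection; $\boldsymbol\lambda_i(t+1)$ is the maximizer over $\boldsymbol\lambda\in\mathbb R^p_+$ of $\sum_s[\boldsymbol\lambda]_s[c_s(\mathbf x_i(t+1))]_+-\frac{\eta_t}2\|\boldsymbol\lambda\|^2$. **Theorem.** Let $\mathbf x^\star$ minimize $\sum_{t=1}^T\sum_{j=1}^N\ell_{j,t}$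 over $\mathcal X$ and let $\mathsf{Reg}(i,T)=\sum_{t=1}^T\sum_{j=1}^N\big(\ell_{j,t}(\mathbf x_i(t))-\ell_{j,t}(\mathbf x^\star)\big)$. All the expectations below are those of integrable random variables, and $$\max_{1\le i\le N}\mathbb E[\mathsf{Reg}(i,T)]\le \tilde C^{\S}_{\mathrm{sc}}\,T^{2/3}\log T,\qquad \sum_{t=1}^T\sum_{i=1}^N\sum_{s=1}^p\mathbb E\big[[c_s(\mathbf x_i(t))]_+\big]\le\bar C^{\S}_{\mathrm{sc}}\sqrt{T\log T},$$ where $$\tilde C^{\S}_{\mathrm{sc}}=3NG+\frac N{2\sigma}\big(4C\hat CGd+4C^2d^2+\hat C^2G^2\big),\qquad \bar C^{\S}_{\mathrm{sc}}=\frac{4pNG}{\sqrt\sigma}\Big(\sqrt{GR}+\frac{Cd}{\sqrt\sigma}\Big),$$ $$\hat C=2N\Big(\frac{3N}{\psi^{2+1/B}(1-\psi^{1/B})}+4\Big),\qquad \psi=1-\frac{\zeta}{4N^2}.$$ -/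

import Mathlib

noncomputable section

open MeasureTheory ProbabilityTheory

namespace DOCO

/-- The Euclidean space `ℝ^d`. -/
abbrev Vec (d : ℕ) := EuclideanSpace ℝ (Fin d)

/-- The ball `𝓑 = {x ∈ ℝ^d | ‖x‖ ≤ R}`. -/
abbrev Ball (d : ℕ) (R : ℝ) : Set (Vec d) := Metric.closedBall 0 R

/-- The data of a distributed online problem with `N` units, decisions in `ℝ^d` and `p` inequality
constraints: `loss t i` is the loss `ℓ_{i,t}`, `con s` the constraint function `c_s`, `edges t` the
edge set at time `t` (`(j, i)` means that `i` receives from `j`), `weight t` the matrix `A(t)`.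
Rounds are numbered from `1`; the values at `t = 0` play no role. -/
structure Problem (d N p : ℕ) where
  loss : ℕ → Fin N → Vec d → ℝ
  con : Fin p → Vec d → ℝ
  edges : ℕ → Set (Fin N × Fin N)
  weight : ℕ → Matrix (Fin N) (Fin N) ℝ

namespace Problem

variable {d N p : ℕ}

/-- The constraint set `𝓧 = {x | c_s(x) ≤ 0, s = 1, …, p}`. -/
def feasible (P : Problem d N p) : Set (Vec d) := {x | ∀ s, P.con s x ≤ 0}

/-- `𝓧 ⊆ 𝓑` with `R > 0`. -/
def ContainedInBall (P : Problem d N p) (R : ℝ) : Prop :=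
  0 < R ∧ P.feasible ⊆ Ball d R

/-- The losses and the constraint functions are convex on `ℝ^d`, and have gradients
on `𝓑` bounded by `Gl` and `Gc`. -/
def ConvexBoundedGradients (P : Problem d N p) (T : ℕ) (R Gl Gc : ℝ) : Prop :=
  (∀ t ∈ Finset.Icc 1 T, ∀ i, ConvexOn ℝ Set.univ (P.loss t i) ∧
    ∀ x ∈ Ball d R, DifferentiableAt ℝ (P.loss t i) x ∧ ‖gradient (P.loss t i) x‖ ≤ Gl) ∧
  (∀ s, ConvexOn ℝ Set.univ (P.con s) ∧
    ∀ x ∈ Ball d R, DifferentiableAt ℝ (P.con s) x ∧ ‖gradient (P.con s) x‖ ≤ Gc)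

/-- The union of the graphs over each window `kB+1, …, (k+1)B` is strongly connected:
there is a directed path between any two nodes. -/
def JointlyConnected (P : Problem d N p) (B : ℕ) : Prop :=
  1 ≤ B ∧ ∀ k : ℕ, ∀ i j : Fin N, Relation.ReflTransGen
    (fun a b => ∃ t ∈ Finset.Icc (k * B + 1) ((k + 1) * B), (a, b) ∈ P.edges t) i j

/-- The weight matrices are doubly stochastic and compatible with the graphs, with nonzero weights
(in particular the diagonal ones) at least `ζ > 0`. -/
def CompatibleWeights (P : Problem d N p) (ζ : ℝ) : Prop :=
  0 < ζ ∧ ∀ t, 1 ≤ t →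
    P.weight t ∈ doublyStochastic ℝ (Fin N) ∧
    (∀ i, ζ ≤ P.weight t i i) ∧
    (∀ i j, (j, i) ∈ P.edges t → ζ ≤ P.weight t i j) ∧
    (∀ i j, i ≠ j → (j, i) ∉ P.edges t → P.weight t i j = 0)

/-- The losses are `σ`-strongly convex over `𝓑`, `σ > 0`. -/
def StronglyConvexLosses (P : Problem d N p) (T : ℕ) (R σ : ℝ) : Prop :=
  0 < σ ∧ ∀ t ∈ Finset.Icc 1 T, ∀ i, ∀ x ∈ Ball d R, ∀ y ∈ Ball d R,
    P.loss t i y + inner ℝ (gradient (P.loss t i) y) (x - y) + σ / 2 * ‖x - y‖ ^ 2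
      ≤ P.loss t i x

/-- The losses are bounded by `C` in absolute value over `𝓑`. -/
def BoundedLosses (P : Problem d N p) (T : ℕ) (R C : ℝ) : Prop :=
  ∀ t ∈ Finset.Icc 1 T, ∀ i, ∀ x ∈ Ball d R, |P.loss t i x| ≤ C

/-- `xstar` is a best fixed decision in hindsight: a minimizer over `𝓧` of
`∑_{t=1}^T ∑_j ℓ_{j,t}`. -/
def IsBestDecision (P : Problem d N p) (T : ℕ) (xstar : Vec d) : Prop :=
  xstar ∈ P.feasible ∧
    IsMinOn (fun x => ∑ t ∈ Finset.Icc 1 T, ∑ j, P.loss t j x) P.feasible xstar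

end Problem

/-- The uniform probability distribution on the unit sphere of `ℝ^d`, as a measure on `ℝ^d`. -/
def uniformSphere (d : ℕ) : Measure (Vec d) :=
  (((volume : Measure (Vec d)).toSphere Set.univ)⁻¹ • (volume : Measure (Vec d)).toSphere).map
    Subtype.val

/-- Euclidean projection onto the ball of radius `r` centred at the origin. -/
def projBall {d : ℕ} (r : ℝ) (x : Vec d) : Vec d :=
  if ‖x‖ ≤ r then x else (r / ‖x‖) • x

theorem projBall_mem {d : ℕ} {r : ℝ} (hr : 0 ≤ r) (x : Vec d) : projBall r x ∈ Ball d r := by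
  unfold projBall
  split_ifs with h
  · simpa using h
  · have hx : 0 < ‖x‖ := lt_of_le_of_lt hr (not_le.mp h)
    simp [norm_smul, abs_of_nonneg hr, hx.ne']

/-- `projBall r x` is a point of the ball nearest to `x`. -/
theorem norm_sub_projBall_le {d : ℕ} {r : ℝ} (hr : 0 ≤ r) (x z : Vec d) (hz : z ∈ Ball d r) :
    ‖x - projBall r x‖ ≤ ‖x - z‖ := by
  unfold projBall
  split_ifs with h
  · simp
  · have hx : 0 < ‖x‖ := lt_of_le_of_lt hr (not_le.mp h)
    have h1 : x - (r / ‖x‖) • x = (1 - r / ‖x‖) • x := by rw [sub_smul, one_smul]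
    have h2 : r / ‖x‖ ≤ 1 := (div_le_one hx).2 (not_le.mp h).le
    rw [h1, norm_smul, Real.norm_of_nonneg (by linarith)]
    have h3 : (1 - r / ‖x‖) * ‖x‖ = ‖x‖ - r := by field_simp
    have h4 : ‖z‖ ≤ r := by simpa using hz
    have h5 := norm_sub_norm_le x z
    linarith

/-- `∂[c(x)]₊`: equal to `∇c(x)` if `c(x) > 0`, and to `0` otherwise. -/
def posPartGrad {d : ℕ} (c : Vec d → ℝ) (x : Vec d) : Vec d :=
  if 0 < c x then gradient c x else 0

/-- One-point gradient estimator `(d/ε) ℓ(x + ε u) u`. -/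
def onePointGrad {d : ℕ} (ℓ : Vec d → ℝ) (ε : ℝ) (x u : Vec d) : Vec d :=
  ((d : ℝ) / ε * ℓ (x + ε • u)) • u

/-- The dual update: the vector with entries `[c_s(x)]₊ / η`. -/
def dualStep {d p : ℕ} (con : Fin p → Vec d → ℝ) (η : ℝ) (x : Vec d) : Vec p :=
  WithLp.toLp 2 fun s => max (con s x) 0 / η

/-- The augmented Lagrangian `ℓ(x) + ∑_s λ_s [c_s(x)]₊ - (η/2) ‖λ‖²` of a loss `ℓ`
(possibly a smoothed one). -/
def lagrangian {d p : ℕ} (ℓ : Vec d → ℝ) (con : Fin p → Vec d → ℝ) (η : ℝ)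
    (x : Vec d) (lam : Vec p) : ℝ :=
  ℓ x + ∑ s, lam s * max (con s x) 0 - η / 2 * ‖lam‖ ^ 2

/-- The dual update is the unique maximizer over the nonnegative orthant of the augmented
Lagrangian, for every (smoothed) loss `ℓ`. -/
theorem eq_dualStep_iff {d p : ℕ} (ℓ : Vec d → ℝ) (con : Fin p → Vec d → ℝ) {η : ℝ} (hη : 0 < η)
    (x : Vec d) (lam : Vec p) :
    lam = dualStep con η x ↔
      (∀ s, 0 ≤ lam s) ∧ ∀ lam' : Vec p, (∀ s, 0 ≤ lam' s) →
        lagrangian ℓ con η x lam' ≤ lagrangian ℓ con η x lam := by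
  have key : ∀ l : Vec p, lagrangian ℓ con η x l =
      lagrangian ℓ con η x (dualStep con η x) - η / 2 * ‖l - dualStep con η x‖ ^ 2 := by
    intro l
    simp only [lagrangian, EuclideanSpace.norm_sq_eq, Finset.mul_sum, Real.norm_eq_abs, sq_abs]
    have : ∀ s, l s * max (con s x) 0 - η / 2 * (l s) ^ 2 =
        (dualStep con η x) s * max (con s x) 0 - η / 2 * ((dualStep con η x) s) ^ 2
          - η / 2 * ((l - dualStep con η x) s) ^ 2 := by
      intro s
      simp only [dualStep, PiLp.sub_apply]
      field_simp
      ring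
    have h := Finset.sum_congr (rfl : (Finset.univ : Finset (Fin p)) = _) fun s _ => this s
    simp only [Finset.sum_sub_distrib] at h
    linarith
  have hnn : ∀ s, 0 ≤ (dualStep con η x) s := fun s => by
    simp only [dualStep]
    positivity
  constructor
  · rintro rfl
    refine ⟨hnn, fun l _ => ?_⟩
    rw [key l]
    have : 0 ≤ η / 2 * ‖l - dualStep con η x‖ ^ 2 := by positivity
    linarith
  · rintro ⟨-, h⟩
    have h1 := h _ hnn
    rw [key lam] at h1
    have h2 : ‖lam - dualStep con η x‖ ^ 2 ≤ 0 := by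
      by_contra hc
      have : 0 < η / 2 * ‖lam - dualStep con η x‖ ^ 2 := mul_pos (by positivity) (not_le.mp hc)
      linarith
    have h3 : ‖lam - dualStep con η x‖ = 0 := by
      have := sq_nonneg ‖lam - dualStep con η x‖
      exact pow_eq_zero_iff (two_ne_zero) |>.1 (le_antisymm h2 this)
    exact sub_eq_zero.1 (norm_eq_zero.1 h3)

/-- The states of all units at the beginning of a round: decisions and dual variables. -/
abbrev State (d N p : ℕ) := (Fin N → Vec d) × (Fin N → Vec p)

/-- The intermediate vectors
`y_i = x_i - β (∇̃ℓ_i(x_i) + ∑_s [λ_i]_s ∂[c_s(x_i)]₊)` of round `t`, for the exploration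
directions `u`. -/
def intermediate {d N p : ℕ} (P : Problem d N p) (t : ℕ) (β ε : ℝ) (u : Fin N → Vec d)
    (S : State d N p) (i : Fin N) : Vec d :=
  S.1 i - β • (onePointGrad (P.loss t i) ε (S.1 i) (u i)
    + ∑ s, (S.2 i) s • posPartGrad (P.con s) (S.1 i))

/-- The new decisions `x_i(t+1) = Π(∑_j [A(t)]_{ij} y_j(t))`, with `Π` the projection onto the ball
of radius `r`. -/
def nextDecision {d N p : ℕ} (P : Problem d N p) (t : ℕ) (β ε r : ℝ) (u : Fin N → Vec d)
    (S : State d N p) (i : Fin N) : Vec d :=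
  projBall r (∑ j, P.weight t i j • intermediate P t β ε u S j)

/-- DOCO-LTC with one-point bandit feedback, for step sizes `β`, regularization parameters `η`,
exploration parameters `ε`, projections onto the ball of radius `r` and a realization `u` of the
exploration directions. `run … t` is the state at the beginning of round `t ≥ 1` (the value at
`t = 0` is a dummy). -/
def run {d N p : ℕ} (P : Problem d N p) (β η ε : ℕ → ℝ) (r : ℝ) (u : ℕ → Fin N → Vec d) :
    ℕ → State d N p
  | 0 => (0, 0)
  | 1 => (0, 0)
  | t + 2 =>
    let S := run P β η ε r u (t + 1)
    let x := nextDecision P (t + 1) (β (t + 1)) (ε (t + 1)) r (u (t + 1)) S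
    (x, fun i => dualStep P.con (η (t + 1)) (x i))

/-- The decisions `x_i(t)` for the horizon `T` with the parameters of strongly convex losses:
`η_t = 2pG²/(σt)`, `β_t = 1/(σt)`, `ε_t = T^{-1/3}`, `π = 1/(R T^{1/3})`, and projections onto
`(1-π)𝓑`, the ball of radius `(1-π)R`. -/
def decision {d N p : ℕ} (P : Problem d N p) (T : ℕ) (R G σ : ℝ) (u : ℕ → Fin N → Vec d)
    (t : ℕ) (i : Fin N) : Vec d :=
  (run P (fun t => 1 / (σ * t)) (fun t => 2 * p * G ^ 2 / (σ * t))
    (fun _ => 1 / (T : ℝ) ^ ((1 : ℝ) / 3))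
    ((1 - 1 / (R * (T : ℝ) ^ ((1 : ℝ) / 3))) * R) u t).1 i

/-- The regret at unit `i` of the decisions `x` with respect to `xstar`. -/
def regret {d N p : ℕ} (P : Problem d N p) (T : ℕ) (xstar : Vec d) (x : ℕ → Fin N → Vec d)
    (i : Fin N) : ℝ :=
  ∑ t ∈ Finset.Icc 1 T, ∑ j, P.loss t j (x t i) - ∑ t ∈ Finset.Icc 1 T, ∑ j, P.loss t j xstar

/-- Expected system-level regret `max_i 𝔼[Reg(i,T)]` of the random decisions `x`. -/
def expectedSystemRegret {d N p : ℕ} {Ω : Type*} [MeasurableSpace Ω] (μ : Measure Ω)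
    (P : Problem d N p) (T : ℕ) (xstar : Vec d) (x : Ω → ℕ → Fin N → Vec d) : ℝ :=
  ⨆ i : Fin N, ∫ ω, regret P T xstar (x ω) i ∂μ

/-- Expected cumulative absolute constraint violation
`∑_{t=1}^T ∑_i ∑_s 𝔼[[c_s(x_i(t))]₊]`. -/
def expectedViolation {d N p : ℕ} {Ω : Type*} [MeasurableSpace Ω] (μ : Measure Ω)
    (P : Problem d N p) (T : ℕ) (x : Ω → ℕ → Fin N → Vec d) : ℝ :=
  ∑ t ∈ Finset.Icc 1 T, ∑ i : Fin N, ∑ s : Fin p, ∫ ω, max (P.con s (x ω t i)) 0 ∂μ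

/-- The random directions `u_i(t)`, `1 ≤ t ≤ T`, are mutually independent and uniformly distributed
on the unit sphere. -/
structure IsExploration {d N : ℕ} {Ω : Type*} [MeasurableSpace Ω] (μ : Measure Ω) (T : ℕ)
    (u : Ω → ℕ → Fin N → Vec d) : Prop where
  measurable : ∀ t ∈ Finset.Icc 1 T, ∀ i, Measurable fun ω => u ω t i
  law : ∀ t ∈ Finset.Icc 1 T, ∀ i, μ.map (fun ω => u ω t i) = uniformSphere d
  indep : iIndepFun (fun (q : Finset.Icc 1 T × Fin N) ω => u ω q.1 q.2) μ

/-- `Ĉ = 2N (3N / (ψ^{2+1/B} (1 - ψ^{1/B})) + 4)` with `ψ = 1 - ζ/(4N²)`. -/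
def cHat (N B : ℕ) (ζ : ℝ) : ℝ :=
  let ψ : ℝ := 1 - ζ / (4 * (N : ℝ) ^ 2)
  2 * N * (3 * N / (ψ ^ (2 + 1 / (B : ℝ)) * (1 - ψ ^ (1 / (B : ℝ)))) + 4)

/-- The constant in the regret bound. -/
def regretConst (d N B : ℕ) (ζ G C σ : ℝ) : ℝ :=
  3 * N * G + N / (2 * σ) *
    (4 * C * cHat N B ζ * G * d + 4 * C ^ 2 * (d : ℝ) ^ 2 + cHat N B ζ ^ 2 * G ^ 2)

/-- The constant in the bound on the constraint violation. -/
def violationConst (d N p : ℕ) (R G C σ : ℝ) : ℝ :=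
  4 * p * N * G / √σ * (√(G * R) + C * d / √σ)

end DOCO

end

/-! Put `ε = T^{-1/3} = πR`. Decisions have norm at most `R - ε`, so every queried point `x + εu`
stays in the ball. The comparator is `z = (1-π)x*`: it is feasible by convexity and `0 ∈ 𝓧`, has
norm at most `R - ε`, and lies within `ε` of `x*`.

Descent. The dual variables are `σ(t-1)/(2pG²) [c_s]₊`, so the inner product of the penalty
direction with `x - z` is at least that factor times `∑ [c_s]₊²`. The step sizes are such that the
squared norm of the penalty costs at most half of this gain (`descent_step`). Averaging and
projecting do not increase the sum of squared distances to `z`, and strong convexity makes the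
distances telescope. Pathwise, the linearized regret plus the weighted squared violations is at most
`N(dC/ε)²/σ` times a harmonic sum (`sum_linearized_regret_le`).

Consensus. Over a connected window averaging contracts the deviation from the mean by a fixed factor
(`norm_deviation_window_le`), so total disagreement is at most a constant times the total length of
the steps (`sum_disagreement_le`), and `le_cHat` bounds that constant by `Ĉ`. The penalty steps
enter linearly in the violations and are absorbed by the squared violations through Young's
inequality (`disagreement_young`).

Expectation. By the divergence theorem on the unit ball the one-point estimator averages the
gradient over the ball of radius `ε`; only a lower bound is needed (`le_integral_onePointGrad`).
Since `u_i(t)` is independent of `x_i(t)`, the expected linearized regret dominates the expected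
regret up to `2Gε` per unit and round (`integral_loss_le_linearized_regret`).

Conclusion. For the regret, the squared violations pay for the disagreement, and both the estimator
variance and the bias `3GεNT` are of order `T^{2/3}` up to a logarithm. For the violation, the
squares are kept, the linearized regret is bounded below by `-2GR` per unit and round, and a
weighted arithmetic-geometric inequality passes from squares to first powers. -/

namespace DOCO

/-! ### Scalar averaging: variance drop and contraction over a connected window -/

open Finset

/-- Averaging with a doubly stochastic matrix lowers the sum of squared distances to a point by the
sum of the variances of the rows. -/
theorem sum_sq_mulVec_add_variance {N : ℕ} {A : Matrix (Fin N) (Fin N) ℝ}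
    (hA : A ∈ doublyStochastic ℝ (Fin N)) (x : Fin N → ℝ) (c : ℝ) :
    ∑ i, (A.mulVec x i - c) ^ 2 + ∑ i, ∑ j, A i j * (x j - A.mulVec x i) ^ 2
      = ∑ j, (x j - c) ^ 2 := by
  obtain ⟨-, hr, hc⟩ := mem_doublyStochastic_iff_sum.1 hA
  have h1 : ∀ i, (A.mulVec x i - c) ^ 2 + ∑ j, A i j * (x j - A.mulVec x i) ^ 2
      = ∑ j, A i j * (x j - c) ^ 2 := by
    intro i
    have hm : A.mulVec x i = ∑ j, A i j * x j := rfl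
    set m := A.mulVec x i
    have : ∀ j, A i j * (x j - c) ^ 2
        = A i j * (x j - m) ^ 2 + 2 * (m - c) * (A i j * x j) - 2 * (m - c) * m * A i j
          + (m - c) ^ 2 * A i j := fun j => by ring
    simp_rw [this, sum_add_distrib, sum_sub_distrib, sum_add_distrib, ← mul_sum, hr, ← hm]
    ring
  rw [← sum_add_distrib, sum_congr rfl fun i _ => h1 i, sum_comm]
  simp_rw [← sum_mul, hc, one_mul]

theorem sum_sq_mulVec_le {N : ℕ} {A : Matrix (Fin N) (Fin N) ℝ}
    (hA : A ∈ doublyStochastic ℝ (Fin N)) (x : Fin N → ℝ) (c : ℝ) :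
    ∑ i, (A.mulVec x i - c) ^ 2 ≤ ∑ j, (x j - c) ^ 2 := by
  have h := sum_sq_mulVec_add_variance hA x c
  have : 0 ≤ ∑ i, ∑ j, A i j * (x j - A.mulVec x i) ^ 2 :=
    sum_nonneg fun i _ => sum_nonneg fun j _ =>
      mul_nonneg ((mem_doublyStochastic_iff_sum.1 hA).1 i j) (sq_nonneg _)
  linarith

/-- Averaging along one edge lowers the sum of squared distances. -/
theorem sum_sq_mulVec_add_le {N : ℕ} {A : Matrix (Fin N) (Fin N) ℝ}
    (hA : A ∈ doublyStochastic ℝ (Fin N)) (x : Fin N → ℝ) (c : ℝ) {ζ : ℝ} (hζ : 0 ≤ ζ)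
    {i j : Fin N} (hij : i ≠ j) (hi : ζ ≤ A i i) (hj : ζ ≤ A i j) :
    ∑ i, (A.mulVec x i - c) ^ 2 + ζ / 2 * (x i - x j) ^ 2 ≤ ∑ j, (x j - c) ^ 2 := by
  rw [← sum_sq_mulVec_add_variance hA x c]
  gcongr
  have hnn := (mem_doublyStochastic_iff_sum.1 hA).1
  set m := A.mulVec x with hm
  have hrow : ∑ k ∈ {i, j}, A i k * (x k - m i) ^ 2 ≤ ∑ k, A i k * (x k - m i) ^ 2 :=
    sum_le_sum_of_subset_of_nonneg (subset_univ _)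
      fun k _ _ => mul_nonneg (hnn i k) (sq_nonneg _)
  have hall : ∑ k, A i k * (x k - m i) ^ 2 ≤ ∑ i, ∑ k, A i k * (x k - m i) ^ 2 :=
    single_le_sum (f := fun i => ∑ k, A i k * (x k - m i) ^ 2)
      (fun i _ => sum_nonneg fun k _ => mul_nonneg (hnn i k) (sq_nonneg _)) (mem_univ i)
  rw [sum_pair hij] at hrow
  have h1 : ζ * (x i - m i) ^ 2 ≤ A i i * (x i - m i) ^ 2 := by gcongr
  have h2 : ζ * (x j - m i) ^ 2 ≤ A i j * (x j - m i) ^ 2 := by gcongr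
  -- With `α`, `β` the two deviations, `α² + β² = (α-β)²/2 + (α+β)²/2`, which is where the factor
  -- `ζ/2` comes from.
  have h3 : 0 ≤ ζ * (x i - m i + (x j - m i)) ^ 2 := by positivity
  nlinarith

/-- A finite family of reals with distinct extreme values leaves a gap of at least the `N`-th part
of the range. -/
theorem exists_gap {N : ℕ} (x : Fin N → ℝ) {i₀ i₁ : Fin N} (h₀ : ∀ i, x i₀ ≤ x i)
    (h₁ : ∀ i, x i ≤ x i₁) (h : x i₀ < x i₁) :
    ∃ a b : ℝ, b - a = (x i₁ - x i₀) / N ∧ x i₀ ≤ a ∧ b ≤ x i₁ ∧ ∀ i, x i ≤ a ∨ b ≤ x i := by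
  have hN : (0 : ℝ) < N := by exact_mod_cast i₀.pos
  have hr : 0 < x i₁ - x i₀ := sub_pos.2 h
  set r := x i₁ - x i₀ with hrdef
  -- Rescale the range to `[0, N]` and record the unit cell of each point. The maximum sits in cell
  -- `N`; if the cells `0, …, N-1` were all occupied too, `N` points would take `N + 1` values.
  let f : Fin N → ℕ := fun i => ⌊(x i - x i₀) / r * N⌋₊
  have hf₁ : f i₁ = N := by simp [f, ← hrdef, hr.ne']
  obtain ⟨k, hk, hkf⟩ : ∃ k < N, ∀ i, f i ≠ k := by
    by_contra! hcon
    have hsub : range (N + 1) ⊆ univ.image f := by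
      intro k hk
      rcases Nat.lt_succ_iff_lt_or_eq.1 (mem_range.1 hk) with hk | rfl
      · obtain ⟨i, hi⟩ := hcon k hk
        exact mem_image.2 ⟨i, mem_univ _, hi⟩
      · exact mem_image.2 ⟨i₁, mem_univ _, hf₁⟩
    have := (card_le_card hsub).trans card_image_le
    simp at this
  have hk' : (k : ℝ) + 1 ≤ N := by exact_mod_cast hk
  refine ⟨x i₀ + k * r / N, x i₀ + (k + 1) * r / N, by ring, ?_, ?_, fun i => ?_⟩
  · have : 0 ≤ k * r / N := by positivity
    linarith
  · have : (k + 1) * r / N ≤ r := by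
      rw [div_le_iff₀ hN, mul_comm r]
      gcongr
    linarith
  · have hv : 0 ≤ (x i - x i₀) / r * N := by
      have := sub_nonneg.2 (h₀ i)
      positivity
    rcases lt_or_gt_of_ne (hkf i) with hlt | hgt
    · left
      have h2 := (Nat.floor_lt hv).1 hlt
      rw [div_mul_eq_mul_div, div_lt_iff₀ hr] at h2
      have : x i - x i₀ ≤ k * r / N := by
        rw [le_div_iff₀ hN]
        exact h2.le
      linarith
    · right
      have h2 : ((k + 1 : ℕ) : ℝ) ≤ (x i - x i₀) / r * N :=
        (Nat.cast_le.2 (Nat.succ_le_of_lt hgt)).trans (Nat.floor_le hv)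
      push_cast at h2
      rw [div_mul_eq_mul_div, le_div_iff₀ hr] at h2
      have : (k + 1) * r / N ≤ x i - x i₀ := by
        rw [div_le_iff₀ hN]
        exact h2
      linarith

/-- Going back along the path from its end, the first vertex met in `S` is the source of the
required edge. Strong connectivity thus supplies an edge across any cut. -/
theorem exists_crossing {α : Type*} {r : α → α → Prop} {S : α → Prop} {i j : α}
    (h : Relation.ReflTransGen r i j) (hi : S i) (hj : ¬ S j) : ∃ a b, r a b ∧ S a ∧ ¬ S b := by
  induction h with
  | refl => exact absurd hi hj
  | @tail b c _ hbc ih =>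
    by_cases hb : S b
    · exact ⟨b, c, hbc, hb, hj⟩
    · exact ih hb

/-- If no weight crosses between the values `≤ a` and the values `≥ b`, then an averaging step keeps
them apart. -/
theorem mulVec_separated {N : ℕ} {A : Matrix (Fin N) (Fin N) ℝ}
    (hA : A ∈ doublyStochastic ℝ (Fin N)) {S : Fin N → Prop} {x : Fin N → ℝ} {a b : ℝ}
    (hS : ∀ i, S i → x i ≤ a) (hS' : ∀ i, ¬ S i → b ≤ x i)
    (h0 : ∀ i j, ¬ (S j ↔ S i) → A i j = 0) :
    (∀ i, S i → A.mulVec x i ≤ a) ∧ ∀ i, ¬ S i → b ≤ A.mulVec x i := by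
  obtain ⟨hnn, hr, -⟩ := mem_doublyStochastic_iff_sum.1 hA
  constructor
  · intro i hi
    calc A.mulVec x i = ∑ j, A i j * x j := rfl
      _ ≤ ∑ j, A i j * a := by
        refine sum_le_sum fun j _ => ?_
        by_cases hj : S j
        · exact mul_le_mul_of_nonneg_left (hS j hj) (hnn i j)
        · rw [h0 i j (by tauto)]; simp
      _ = a := by rw [← sum_mul, hr, one_mul]
  · intro i hi
    calc b = ∑ j, A i j * b := by rw [← sum_mul, hr, one_mul]
      _ ≤ ∑ j, A i j * x j := by
        refine sum_le_sum fun j _ => ?_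
        by_cases hj : S j
        · rw [h0 i j (by tauto)]; simp
        · exact mul_le_mul_of_nonneg_left (hS' j hj) (hnn i j)

/-- Averaging over a window whose union of graphs is strongly connected contracts the variance. -/
theorem sum_sq_window_le {N B : ℕ} {A : ℕ → Matrix (Fin N) (Fin N) ℝ}
    {Ed : ℕ → Set (Fin N × Fin N)} {ζ : ℝ} (hζ : 0 < ζ)
    (hA : ∀ m < B, A m ∈ doublyStochastic ℝ (Fin N))
    (hdiag : ∀ m < B, ∀ i, ζ ≤ A m i i)
    (hedge : ∀ m < B, ∀ i j, (j, i) ∈ Ed m → ζ ≤ A m i j)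
    (hnone : ∀ m < B, ∀ i j, i ≠ j → (j, i) ∉ Ed m → A m i j = 0)
    (hconn : ∀ i j, Relation.ReflTransGen (fun a b => ∃ m < B, (a, b) ∈ Ed m) i j)
    {x : ℕ → Fin N → ℝ} (hx : ∀ m < B, x (m + 1) = (A m).mulVec (x m)) {c : ℝ}
    (hc : N * c = ∑ i, x 0 i) :
    ∑ i, (x B i - c) ^ 2 ≤ (1 - ζ / (2 * N ^ 3)) * ∑ i, (x 0 i - c) ^ 2 := by
  rcases Nat.eq_zero_or_pos N with rfl | hNpos
  · simp
  have hN : (0 : ℝ) < N := by exact_mod_cast hNpos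
  have : Nonempty (Fin N) := ⟨⟨0, hNpos⟩⟩
  have hmono : ∀ n m, n + m ≤ B → ∑ i, (x (n + m) i - c) ^ 2 ≤ ∑ i, (x n i - c) ^ 2 := by
    intro n m
    induction m with
    | zero => intro _; exact le_rfl
    | succ m ih =>
      intro h
      rw [← add_assoc, hx (n + m) (by omega)]
      exact (sum_sq_mulVec_le (hA _ (by omega)) _ _).trans (ih (by omega))
  obtain ⟨i₀, h₀⟩ := Finite.exists_min (x 0)
  obtain ⟨i₁, h₁⟩ := Finite.exists_max (x 0)
  have hc0 : x 0 i₀ ≤ c := by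
    have : ∑ _i : Fin N, x 0 i₀ ≤ ∑ i, x 0 i := sum_le_sum fun i _ => h₀ i
    rw [← hc] at this
    simp only [sum_const, card_univ, Fintype.card_fin, nsmul_eq_mul] at this
    exact le_of_mul_le_mul_left this hN
  have hc1 : c ≤ x 0 i₁ := by
    have : ∑ i, x 0 i ≤ ∑ _i : Fin N, x 0 i₁ := sum_le_sum fun i _ => h₁ i
    rw [← hc] at this
    simp only [sum_const, card_univ, Fintype.card_fin, nsmul_eq_mul] at this
    exact le_of_mul_le_mul_left this hN
  have hV : ∑ i, (x 0 i - c) ^ 2 ≤ N * (x 0 i₁ - x 0 i₀) ^ 2 := by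
    calc ∑ i, (x 0 i - c) ^ 2 ≤ ∑ _i : Fin N, (x 0 i₁ - x 0 i₀) ^ 2 := by
          refine sum_le_sum fun i _ => sq_le_sq.2 ?_
          rw [abs_of_nonneg (sub_nonneg.2 (h₀ i₁))]
          exact abs_sub_le_iff.2 ⟨by linarith [h₁ i], by linarith [h₀ i]⟩
      _ = _ := by simp
  rcases (h₀ i₁).eq_or_lt with heq | hlt
  · have hle : ∑ i, (x 0 i - c) ^ 2 ≤ 0 := by simpa [heq] using hV
    have heq0 : ∑ i, (x 0 i - c) ^ 2 = 0 := le_antisymm hle (sum_nonneg fun i _ => sq_nonneg _)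
    rw [heq0, mul_zero, ← heq0]
    simpa using hmono 0 B (by omega)
  obtain ⟨a, b, hab, ha, hb, hgap⟩ := exists_gap (x 0) h₀ h₁ hlt
  -- Cut the units at the gap. Strong connectivity gives an edge across the cut somewhere in the
  -- window; the earliest such time `m` is used below, since up to then no weight crosses the cut
  -- and the gap persists.
  have hbapos : 0 < b - a := by rw [hab]; exact div_pos (sub_pos.2 hlt) hN
  let S : Fin N → Prop := fun i => x 0 i ≤ a
  have hex : ∃ m, m < B ∧ ∃ j i, (j, i) ∈ Ed m ∧ ¬ (S j ↔ S i) := by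
    obtain ⟨j, i, ⟨m, hm, he⟩, hj, hi⟩ := exists_crossing (S := S) (hconn i₀ i₁) ha
      (fun h => by simp only [S] at h; linarith)
    exact ⟨m, hm, j, i, he, by tauto⟩
  classical
  obtain ⟨hmB, j, i, he, hji⟩ := Nat.find_spec hex
  set m := Nat.find hex with hmdef
  have hsep : ∀ n ≤ m, (∀ i, S i → x n i ≤ a) ∧ ∀ i, ¬ S i → b ≤ x n i := by
    intro n
    induction n with
    | zero => exact fun _ => ⟨fun i hi => hi, fun i hi => (hgap i).resolve_left hi⟩
    | succ n ih =>
      intro hn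
      obtain ⟨h1, h2⟩ := ih (by omega)
      have hnB : n < B := by omega
      rw [hx n hnB]
      refine mulVec_separated (hA n hnB) h1 h2 fun i j hij => ?_
      refine hnone n hnB i j (fun h => hij (by rw [h])) fun hmem => ?_
      exact Nat.find_min hex (m := n) (by omega) ⟨hnB, j, i, hmem, hij⟩
  obtain ⟨hs1, hs2⟩ := hsep m le_rfl
  have hdrop := sum_sq_mulVec_add_le (hA m hmB) (x m) c hζ.le (i := i) (j := j)
    (fun h => hji (by rw [h])) (hdiag m hmB i) (hedge m hmB i j he)
  rw [← hx m hmB] at hdrop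
  have hsq : (b - a) ^ 2 ≤ (x m i - x m j) ^ 2 := by
    by_cases hi : S i
    · have := hs1 i hi
      have := hs2 j (by tauto)
      nlinarith
    · have := hs2 i hi
      have := hs1 j (by tauto)
      nlinarith
  have hA1 := hmono 0 m (by omega)
  have hA2 := hmono (m + 1) (B - (m + 1)) (by omega)
  rw [zero_add] at hA1
  rw [Nat.add_sub_cancel' (by omega : m + 1 ≤ B)] at hA2
  have h3 : ζ / 2 * (b - a) ^ 2 ≤ ζ / 2 * (x m i - x m j) ^ 2 := by gcongr
  -- The gap is the range divided by `N`, losing `N²`, and the sum of squares is at most `N` times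
  -- the squared range; together these give `N³`.
  have h4 : ζ / (2 * N ^ 3) * ∑ i, (x 0 i - c) ^ 2 ≤ ζ / 2 * (b - a) ^ 2 := by
    calc ζ / (2 * N ^ 3) * ∑ i, (x 0 i - c) ^ 2
        ≤ ζ / (2 * N ^ 3) * (N * (x 0 i₁ - x 0 i₀) ^ 2) := by gcongr
      _ = ζ / 2 * (b - a) ^ 2 := by rw [hab]; field_simp
  linarith

/-- Summing a recursion that contracts over windows of length `B`. -/
theorem sum_le_of_window_contraction {D E : ℕ → ℝ} {B : ℕ} {ρ : ℝ} (hρ : ρ < 1) (hD0 : D 0 = 0)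
    (hD : ∀ t, 0 ≤ D t) (hE : ∀ t, 0 ≤ E t)
    (hstep : ∀ k, ∀ m < B, D (k * B + m) ≤ D (k * B) + ∑ s ∈ range m, E (k * B + s))
    (hwin : ∀ k, D ((k + 1) * B) ≤ ρ * D (k * B) + ∑ s ∈ range B, E (k * B + s)) (K : ℕ) :
    ∑ t ∈ range (K * B), D t ≤ B * (1 / (1 - ρ) + 1) * ∑ t ∈ range (K * B), E t := by
  -- Telescoping `hwin` controls the values at window starts; `h2` then pays for each of the `B`
  -- times inside a window with its start plus the whole perturbation of the window.
  have h1 : ∀ K : ℕ, (1 - ρ) * ∑ k ∈ range K, D (k * B) + D (K * B)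
      ≤ ∑ t ∈ range (K * B), E t := by
    intro K
    induction K with
    | zero => simp [hD0]
    | succ K ih =>
      have := hwin K
      rw [sum_range_succ, Nat.succ_mul, sum_range_add, ← Nat.succ_mul]
      linarith
  have h2 : ∀ K : ℕ, ∑ t ∈ range (K * B), D t
      ≤ B * (∑ k ∈ range K, D (k * B) + ∑ t ∈ range (K * B), E t) := by
    intro K
    induction K with
    | zero => simp
    | succ K ih =>
      rw [sum_range_succ _ K, Nat.succ_mul, sum_range_add, sum_range_add]
      have : ∑ m ∈ range B, D (K * B + m)
          ≤ ∑ m ∈ range B, (D (K * B) + ∑ s ∈ range B, E (K * B + s)) := by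
        refine sum_le_sum fun m hm => (hstep K m (mem_range.1 hm)).trans ?_
        gcongr
        · exact fun _ _ _ => hE _
        · exact (mem_range.1 hm).le
      rw [sum_const, card_range, nsmul_eq_mul] at this
      linarith
  have hρ' : 0 < 1 - ρ := by linarith
  refine (h2 K).trans ?_
  have h3 : ∑ k ∈ range K, D (k * B) ≤ 1 / (1 - ρ) * ∑ t ∈ range (K * B), E t := by
    rw [one_div_mul_eq_div, le_div_iff₀ hρ', mul_comm]
    linarith [h1 K, hD (K * B)]
  rw [mul_assoc, add_mul, one_mul]
  gcongr

end DOCO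

/-! ### Vector states: deviation from the mean and disagreement under perturbed averaging -/

namespace DOCO

open Finset

/-- The average of the decisions of all units. -/
noncomputable def mean {d N : ℕ} (X : Fin N → Vec d) : Vec d := (N : ℝ)⁻¹ • ∑ i, X i

/-- The deviations from the average. -/
noncomputable def deviation {d N : ℕ} (X : Fin N → Vec d) : PiLp 2 fun _ : Fin N => Vec d :=
  WithLp.toLp 2 fun i => X i - mean X

/-- One averaging step. -/
noncomputable def average {d N : ℕ} (A : Matrix (Fin N) (Fin N) ℝ) (X : Fin N → Vec d)
    (i : Fin N) : Vec d :=
  ∑ j, A i j • X j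

section

variable {d N : ℕ}

theorem average_apply (A : Matrix (Fin N) (Fin N) ℝ) (X : Fin N → Vec d) (i : Fin N) (k : Fin d) :
    average A X i k = A.mulVec (fun j => X j k) i := by
  simp [average, Matrix.mulVec, dotProduct]

theorem average_sub (A : Matrix (Fin N) (Fin N) ℝ) (X Y : Fin N → Vec d) :
    average A (X - Y) = average A X - average A Y := by
  ext1 i
  simp [average, smul_sub]

theorem mean_average {A : Matrix (Fin N) (Fin N) ℝ} (hA : A ∈ doublyStochastic ℝ (Fin N))
    (X : Fin N → Vec d) : mean (average A X) = mean X := by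
  unfold mean average
  rw [sum_comm]
  simp_rw [← sum_smul, (mem_doublyStochastic_iff_sum.1 hA).2.2, one_smul]

theorem deviation_add (X Y : Fin N → Vec d) :
    deviation (X + Y) = deviation X + deviation Y := by
  ext1 i
  simp only [deviation, mean, Pi.add_apply, sum_add_distrib, smul_add, PiLp.add_apply]
  abel

theorem norm_deviation_sq (X : Fin N → Vec d) :
    ‖deviation X‖ ^ 2 = ∑ k, ∑ i, (X i k - mean X k) ^ 2 := by
  rw [PiLp.norm_sq_eq_of_L2, sum_comm]
  refine sum_congr rfl fun i _ => ?_
  rw [EuclideanSpace.norm_sq_eq]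
  simp [deviation]

theorem mul_mean_apply (hN : N ≠ 0) (X : Fin N → Vec d) (k : Fin d) :
    (N : ℝ) * mean X k = ∑ i, X i k := by
  have : (N : ℝ) ≠ 0 := by exact_mod_cast hN
  simp [mean, this]

/-- Subtracting the mean is an orthogonal projection, so it lowers the sum of squares, and the `ℓ²`
norm is at most the `ℓ¹` norm. -/
theorem norm_deviation_le (X : Fin N → Vec d) : ‖deviation X‖ ≤ ∑ i, ‖X i‖ := by
  rcases eq_or_ne N 0 with rfl | hN
  · have : ‖deviation X‖ ^ 2 = 0 := by rw [norm_deviation_sq]; simp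
    simp [pow_eq_zero_iff (two_ne_zero)] at this
    simp [this]
  refine abs_le_of_sq_le_sq' ?_ (sum_nonneg fun i _ => norm_nonneg _) |>.2
  calc ‖deviation X‖ ^ 2 = ∑ k, ∑ i, (X i k - mean X k) ^ 2 := norm_deviation_sq X
    _ ≤ ∑ k, ∑ i, (X i k) ^ 2 := by
      refine sum_le_sum fun k _ => ?_
      have h := mul_mean_apply hN X k
      set m := mean X k
      have : ∀ i, (X i k - m) ^ 2 = X i k ^ 2 - 2 * m * X i k + m ^ 2 := fun i => by ring
      simp_rw [this, sum_add_distrib, sum_sub_distrib, ← mul_sum, ← h]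
      simp only [sum_const, card_univ, Fintype.card_fin, nsmul_eq_mul]
      nlinarith [mul_nonneg (Nat.cast_nonneg (α := ℝ) N) (sq_nonneg m)]
    _ = ∑ i, ‖X i‖ ^ 2 := by
      rw [sum_comm]
      refine sum_congr rfl fun i _ => ?_
      rw [EuclideanSpace.norm_sq_eq]
      simp
    _ ≤ (∑ i, ‖X i‖) ^ 2 := sum_sq_le_sq_sum_of_nonneg fun i _ => norm_nonneg _

theorem norm_deviation_average_le {A : Matrix (Fin N) (Fin N) ℝ}
    (hA : A ∈ doublyStochastic ℝ (Fin N)) (X : Fin N → Vec d) :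
    ‖deviation (average A X)‖ ≤ ‖deviation X‖ := by
  refine abs_le_of_sq_le_sq' ?_ (norm_nonneg _) |>.2
  rw [norm_deviation_sq, norm_deviation_sq, mean_average hA]
  refine sum_le_sum fun k _ => ?_
  simp_rw [average_apply]
  exact sum_sq_mulVec_le hA _ _

theorem sum_norm_sub_le (X : Fin N → Vec d) (i : Fin N) :
    ∑ j, ‖X i - X j‖ ≤ 2 * N * ‖deviation X‖ := by
  have h : ∀ j, ‖X j - mean X‖ ≤ ‖deviation X‖ := fun j => PiLp.norm_apply_le (deviation X) j
  calc ∑ j, ‖X i - X j‖ ≤ ∑ _j : Fin N, 2 * ‖deviation X‖ := by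
        refine sum_le_sum fun j _ => ?_
        have := norm_sub_le (X i - mean X) (X j - mean X)
        rw [sub_sub_sub_cancel_right] at this
        linarith [h i, h j]
    _ = _ := by simp; ring

/-- Averaging over a window whose union of graphs is strongly connected contracts deviations. -/
theorem norm_deviation_window_le {B : ℕ} {A : ℕ → Matrix (Fin N) (Fin N) ℝ}
    {Ed : ℕ → Set (Fin N × Fin N)} {ζ : ℝ} (hζ : 0 < ζ) (hζ1 : ζ ≤ 1)
    (hA : ∀ m < B, A m ∈ doublyStochastic ℝ (Fin N))
    (hdiag : ∀ m < B, ∀ i, ζ ≤ A m i i)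
    (hedge : ∀ m < B, ∀ i j, (j, i) ∈ Ed m → ζ ≤ A m i j)
    (hnone : ∀ m < B, ∀ i j, i ≠ j → (j, i) ∉ Ed m → A m i j = 0)
    (hconn : ∀ i j, Relation.ReflTransGen (fun a b => ∃ m < B, (a, b) ∈ Ed m) i j)
    {X : ℕ → Fin N → Vec d} (hX : ∀ m < B, X (m + 1) = average (A m) (X m)) :
    ‖deviation (X B)‖ ≤ (1 - ζ / (4 * N ^ 3)) * ‖deviation (X 0)‖ := by
  rcases eq_or_ne N 0 with hN | hN
  · have h0 : ∀ Y : Fin N → Vec d, ‖deviation Y‖ = 0 := fun Y => by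
      have : ‖deviation Y‖ ^ 2 = 0 := by
        subst hN
        rw [norm_deviation_sq]; simp
      exact pow_eq_zero_iff two_ne_zero |>.1 this
    simp [h0]
  have hmean : ∀ m ≤ B, mean (X m) = mean (X 0) := by
    intro m
    induction m with
    | zero => simp
    | succ m ih => intro h; rw [hX m h, mean_average (hA m h), ih (by omega)]
  have hN1 : (1 : ℝ) ≤ N := by exact_mod_cast Nat.one_le_iff_ne_zero.2 hN
  have hN3 : (1 : ℝ) ≤ (N : ℝ) ^ 3 := one_le_pow₀ hN1
  have hy : ζ / (4 * N ^ 3) ≤ 1 := by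
    rw [div_le_one (by positivity)]
    linarith
  refine abs_le_of_sq_le_sq' ?_ (mul_nonneg (by linarith) (norm_nonneg _)) |>.2
  have hsq : ‖deviation (X B)‖ ^ 2 ≤ (1 - ζ / (2 * N ^ 3)) * ‖deviation (X 0)‖ ^ 2 := by
    rw [norm_deviation_sq, norm_deviation_sq, hmean B le_rfl, mul_sum]
    refine sum_le_sum fun k _ => ?_
    exact sum_sq_window_le (x := fun m i => X m i k) hζ hA hdiag hedge hnone hconn
      (fun m hm => by ext i; simp only [hX m hm, average_apply]) (mul_mean_apply hN _ k)
  refine hsq.trans ?_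
  rw [mul_pow]
  gcongr
  -- Taking the square root of the contraction factor: `1 - 2y ≤ (1 - y)²`.
  have : ζ / (2 * N ^ 3) = 2 * (ζ / (4 * N ^ 3)) := by field_simp; norm_num
  rw [this]
  nlinarith [sq_nonneg (ζ / (4 * (N : ℝ) ^ 3))]

/-- The weights of a compatible network do not exceed `1`. -/
theorem Problem.CompatibleWeights.le_one {p : ℕ} {P : Problem d N p} {ζ : ℝ}
    (h : P.CompatibleWeights ζ) (i : Fin N) : ζ ≤ 1 := by
  obtain ⟨hA, hd, -, -⟩ := h.2 1 le_rfl
  obtain ⟨hnn, hr, -⟩ := mem_doublyStochastic_iff_sum.1 hA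
  refine (hd i).trans ?_
  rw [← hr i]
  exact single_le_sum (f := fun j => P.weight 1 i j) (fun j _ => hnn i j) (mem_univ i)

/-- The cumulative disagreement between units is controlled by the cumulative perturbation of the
averaging dynamics. -/
theorem sum_disagreement_le {p : ℕ} {P : Problem d N p} {B : ℕ} {ζ : ℝ}
    (hconn : P.JointlyConnected B) (hweight : P.CompatibleWeights ζ) {T : ℕ}
    {X e : ℕ → Fin N → Vec d} (hX1 : X 1 = 0)
    (hX : ∀ t, 1 ≤ t → t < T → X (t + 1) = average (P.weight t) (X t) + e t) (i : Fin N) :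
    ∑ t ∈ Icc 1 T, ∑ j, ‖X t i - X t j‖
      ≤ 2 * N * (B * (4 * N ^ 3 / ζ + 1)) * ∑ t ∈ Icc 1 T, ∑ j, ‖e t j‖ := by
  have hζ := hweight.1
  have hζ1 := hweight.le_one i
  have hN : 0 < N := i.pos
  have hNR : (0 : ℝ) < N := by exact_mod_cast hN
  -- The recursion is known only before `T`. Switching the perturbation off afterwards extends it to
  -- `T * B` rounds, a whole number of windows, at no cost. Times are shifted by one so that windows
  -- start at multiples of `B`.
  let e' : ℕ → Fin N → Vec d := fun n => if n + 1 < T then e (n + 1) else 0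
  let Z : ℕ → Fin N → Vec d := fun n =>
    Nat.rec 0 (fun n z => average (P.weight (n + 1)) z + e' n) n
  have hZ : ∀ n, Z (n + 1) = average (P.weight (n + 1)) (Z n) + e' n := fun n => rfl
  have hZX : ∀ n < T, Z n = X (n + 1) := by
    intro n
    induction n with
    | zero => intro _; exact hX1.symm
    | succ n ih =>
      intro h
      rw [hZ, ih (by omega), hX (n + 1) (by omega) h]
      simp [e', h]
  have hDS : ∀ n, P.weight (n + 1) ∈ doublyStochastic ℝ (Fin N) :=
    fun n => (hweight.2 (n + 1) (by omega)).1
  let D : ℕ → ℝ := fun n => ‖deviation (Z n)‖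
  let E : ℕ → ℝ := fun n => ∑ j, ‖e' n j‖
  have hE : ∀ n, 0 ≤ E n := fun n => sum_nonneg fun j _ => norm_nonneg _
  -- Compare with the unperturbed averaging `F` restarted at time `a`: each perturbation enters the
  -- difference once, and later averaging does not amplify its deviation.
  have hmain : ∀ a m (F : ℕ → Fin N → Vec d), F 0 = Z a →
      (∀ m, F (m + 1) = average (P.weight (a + m + 1)) (F m)) →
      ‖deviation (Z (a + m))‖ ≤ ‖deviation (F m)‖ + ∑ s ∈ range m, E (a + s) := by
    intro a m F hF0 hF
    have h1 : ‖deviation (Z (a + m) - F m)‖ ≤ ∑ s ∈ range m, E (a + s) := by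
      induction m with
      | zero =>
        rw [hF0, add_zero, sub_self]
        simpa using norm_deviation_le (0 : Fin N → Vec d)
      | succ m ih =>
        have : Z (a + (m + 1)) - F (m + 1)
            = average (P.weight (a + m + 1)) (Z (a + m) - F m) + e' (a + m) := by
          rw [average_sub, hF, ← add_assoc, hZ]
          abel
        rw [this, deviation_add, sum_range_succ]
        refine (norm_add_le _ _).trans (add_le_add ?_ (norm_deviation_le _))
        exact (norm_deviation_average_le (hDS _) _).trans ih
    have h2 := norm_add_le (deviation (F m)) (deviation (Z (a + m) - F m))
    rw [← deviation_add, add_sub_cancel] at h2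
    linarith
  let F : ℕ → ℕ → Fin N → Vec d := fun a m =>
    Nat.rec (Z a) (fun m z => average (P.weight (a + m + 1)) z) m
  have hF0 : ∀ a, F a 0 = Z a := fun a => rfl
  have hF : ∀ a m, F a (m + 1) = average (P.weight (a + m + 1)) (F a m) := fun a m => rfl
  have hFle : ∀ a m, ‖deviation (F a m)‖ ≤ ‖deviation (Z a)‖ := by
    intro a m
    induction m with
    | zero => rw [hF0]
    | succ m ih => rw [hF]; exact (norm_deviation_average_le (hDS _) _).trans ih
  have hsum := sum_le_of_window_contraction (D := D) (E := E) (B := B) (ρ := 1 - ζ / (4 * N ^ 3))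
    (by have : 0 < ζ / (4 * N ^ 3) := by positivity
        linarith)
    (by have := norm_deviation_le (0 : Fin N → Vec d)
        simp only [Pi.zero_apply, norm_zero, sum_const_zero] at this
        exact le_antisymm this (norm_nonneg _)) (fun t => norm_nonneg _) hE
    (fun k m _ => (hmain (k * B) m (F (k * B)) (hF0 _) (hF _)).trans
      (add_le_add_left (hFle _ _) _))
    (fun k => by
      have h1 := hmain (k * B) B (F (k * B)) (hF0 _) (hF _)
      rw [← Nat.succ_mul] at h1
      refine h1.trans (add_le_add_left ?_ _)
      refine norm_deviation_window_le (A := fun m => P.weight (k * B + m + 1))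
        (Ed := fun m => P.edges (k * B + m + 1)) (X := F (k * B)) hζ hζ1 (fun m _ => hDS _)
        (fun m _ => (hweight.2 _ (by omega)).2.1) (fun m _ => (hweight.2 _ (by omega)).2.2.1)
        (fun m _ => (hweight.2 _ (by omega)).2.2.2) (fun i j => ?_) (fun m _ => hF _ m)
      refine Relation.ReflTransGen.mono (fun a b => ?_) i j (hconn.2 k i j)
      rintro ⟨t, ht, hab⟩
      rw [Finset.mem_Icc, Nat.succ_mul] at ht
      refine ⟨t - (k * B + 1), by omega, ?_⟩
      have : k * B + (t - (k * B + 1)) + 1 = t := by omega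
      rwa [this]) T
  have hTB : T ≤ T * B := Nat.le_mul_of_pos_right T hconn.1
  have hEsum : ∑ t ∈ range (T * B), E t ≤ ∑ t ∈ Icc 1 T, ∑ j, ‖e t j‖ := by
    have h1 : ∑ t ∈ range (T * B), E t = ∑ t ∈ range T, E t := by
      refine (sum_subset (range_mono hTB) fun t _ ht => ?_).symm
      have : ¬ t + 1 < T := by simp at ht; omega
      simp [E, e', this]
    rw [h1, ← Finset.Ico_add_one_right_eq_Icc, sum_Ico_eq_sum_range]
    refine sum_le_sum fun t _ => ?_
    by_cases h : t + 1 < T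
    · simp [E, e', h, add_comm]
    · simp only [E, e', h, if_false, Pi.zero_apply, norm_zero, sum_const_zero]
      exact sum_nonneg fun j _ => norm_nonneg _
  have hDsum : ∑ t ∈ Icc 1 T, ∑ j, ‖X t i - X t j‖ ≤ 2 * N * ∑ t ∈ range (T * B), D t := by
    calc ∑ t ∈ Icc 1 T, ∑ j, ‖X t i - X t j‖ ≤ ∑ t ∈ range T, 2 * N * D t := by
          rw [← Finset.Ico_add_one_right_eq_Icc, sum_Ico_eq_sum_range]
          refine sum_le_sum fun t ht => ?_
          have : Z t = X (1 + t) := by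
            rw [hZX t (by simpa using ht), add_comm]
          simp only [D, this]
          exact sum_norm_sub_le _ i
      _ = 2 * N * ∑ t ∈ range T, D t := by rw [mul_sum]
      _ ≤ _ := by
        gcongr
  have hconst : 1 / (1 - (1 - ζ / (4 * (N : ℝ) ^ 3))) = 4 * N ^ 3 / ζ := by
    rw [sub_sub_cancel, one_div_div]
  rw [hconst] at hsum
  calc _ ≤ _ := hDsum
    _ ≤ 2 * N * (B * (4 * N ^ 3 / ζ + 1) * ∑ t ∈ range (T * B), E t) := by gcongr
    _ ≤ 2 * N * (B * (4 * N ^ 3 / ζ + 1) * ∑ t ∈ Icc 1 T, ∑ j, ‖e t j‖) := by gcongr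
    _ = _ := by ring

end

/-- Reconciles the contraction constant proved here with `Ĉ`. With `κ = ζ/(4N²)` one has `4N³/ζ =
N/κ`, and `B/κ` is compared with `1/(1-q)` for `q = ψ^{1/B}`. The remaining inequalities have slack.
-/
theorem le_cHat {N B : ℕ} {ζ : ℝ} (hN : 1 ≤ N) (hB : 1 ≤ B) (hζ : 0 < ζ) (hζ1 : ζ ≤ 1) :
    2 * N * (B * (4 * N ^ 3 / ζ + 1)) ≤ cHat N B ζ := by
  have hNR : (1 : ℝ) ≤ N := by exact_mod_cast hN
  have hBR : (1 : ℝ) ≤ B := by exact_mod_cast hB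
  have hN0 : (0 : ℝ) < N := by linarith
  unfold cHat
  simp only
  set κ : ℝ := ζ / (4 * (N : ℝ) ^ 2) with hκdef
  have hκ : 0 < κ := by positivity
  have hκ1 : κ ≤ 1 / 4 := by
    rw [hκdef, div_le_div_iff₀ (by positivity) (by norm_num)]
    nlinarith
  have hψ : 0 < 1 - κ := by linarith
  rw [Real.rpow_add hψ]
  norm_cast
  push_cast
  set q : ℝ := (1 - κ) ^ (1 / (B : ℝ)) with hqdef
  have hq : 0 < q := Real.rpow_pos_of_pos hψ _
  have hqB : q ^ B = 1 - κ := by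
    rw [hqdef, ← Real.rpow_natCast, ← Real.rpow_mul hψ.le, one_div,
      inv_mul_cancel₀ (by positivity), Real.rpow_one]
  have hq1 : q < 1 := Real.rpow_lt_one hψ.le (by linarith) (by positivity)
  -- Bernoulli for `1/q`: `1 + B(1/q - 1) ≤ q^{-B} = 1/(1-κ)`, together with `1 - q ≤ 1/q - 1`.
  have hbern : (B : ℝ) * (1 - κ) * (1 - q) ≤ κ := by
    have h := one_add_mul_le_pow (a := 1 / q - 1) (by have : 0 < 1 / q := by positivity
                                                      linarith) B
    rw [add_sub_cancel, one_div, inv_pow, hqB] at h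
    have h1 : 1 - q ≤ q⁻¹ - 1 := by
      have : q * q⁻¹ = 1 := mul_inv_cancel₀ hq.ne'
      nlinarith [sq_nonneg (1 - q), inv_pos.2 hq]
    have h2 : 1 + B * (1 - q) ≤ (1 - κ)⁻¹ := le_trans (by gcongr) h
    rw [← one_div, le_div_iff₀ hψ] at h2
    linarith
  have hq1' : 0 < 1 - q := by linarith
  have hkey : B * (4 * N ^ 3 / ζ + 1) ≤ N / ((1 - κ) ^ 2 * (1 - q)) := by
    have e1 : 4 * (N : ℝ) ^ 3 / ζ = N / κ := by rw [hκdef]; field_simp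
    rw [e1, le_div_iff₀ (by positivity)]
    have e2 : (N : ℝ) / κ + 1 ≤ N / (κ * (1 - κ)) := by
      rw [div_add_one hκ.ne', div_le_div_iff₀ hκ (by positivity)]
      nlinarith [mul_pos hκ hκ, mul_pos (mul_pos hκ hκ) hκ]
    calc B * ((N : ℝ) / κ + 1) * ((1 - κ) ^ 2 * (1 - q))
        ≤ B * (N / (κ * (1 - κ))) * ((1 - κ) ^ 2 * (1 - q)) := by gcongr
      _ = N / κ * (B * (1 - κ) * (1 - q)) := by field_simp
      _ ≤ N / κ * κ := by gcongr
      _ = N := by field_simp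
  have h3 : (N : ℝ) / ((1 - κ) ^ 2 * (1 - q)) ≤ 3 * N / ((1 - κ) ^ 2 * q * (1 - q)) := by
    rw [div_le_div_iff₀ (by positivity) (by positivity)]
    have : 0 ≤ (N : ℝ) * ((1 - κ) ^ 2 * (1 - q)) := by positivity
    nlinarith
  gcongr
  linarith

end DOCO

/-! ### Uniform sphere measure and a divergence inequality for Lipschitz functions -/

namespace DOCO

open MeasureTheory Filter Topology Metric Set Module

section

variable {d : ℕ}

theorem nontrivial_vec (hd : 1 ≤ d) : Nontrivial (Vec d) := by
  have : Nonempty (Fin d) := ⟨⟨0, hd⟩⟩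
  infer_instance

theorem integral_uniformSphere (h : Vec d → ℝ) :
    ∫ u, h u ∂uniformSphere d = ((volume : Measure (Vec d)).toSphere.real univ)⁻¹
      * ∫ u : sphere (0 : Vec d) 1, h u ∂(volume : Measure (Vec d)).toSphere := by
  rw [uniformSphere, (MeasurableEmbedding.subtype_coe isClosed_sphere.measurableSet).integral_map,
    integral_smul_measure, ENNReal.toReal_inv, smul_eq_mul]
  rfl

theorem ae_norm_eq_one_uniformSphere : ∀ᵐ u ∂uniformSphere d, ‖u‖ = 1 := by
  rw [uniformSphere, ae_map_iff measurable_subtype_coe.aemeasurable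
    (measurableSet_eq_fun measurable_norm measurable_const)]
  exact .of_forall fun u => by simp

/-- Direction and norm of a point separate under the Lebesgue measure. -/
theorem integral_direction_mul_norm (hd : 1 ≤ d) (h : Vec d → ℝ) (φ : ℝ → ℝ) :
    ∫ v : Vec d, φ ‖v‖ * h (‖v‖⁻¹ • v) = (∫ v : Vec d, φ ‖v‖) * ∫ u, h u ∂uniformSphere d := by
  have := nontrivial_vec hd
  have key : ∀ k : Vec d → ℝ, ∫ v : Vec d, φ ‖v‖ * k (‖v‖⁻¹ • v)
      = (∫ u : sphere (0 : Vec d) 1, k u ∂(volume : Measure (Vec d)).toSphere)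
        * ∫ r : Ioi (0 : ℝ), φ r ∂Measure.volumeIoiPow (finrank ℝ (Vec d) - 1) := by
    intro k
    calc ∫ v : Vec d, φ ‖v‖ * k (‖v‖⁻¹ • v)
        = ∫ v : ({(0 : Vec d)}ᶜ : Set (Vec d)), φ ‖v.1‖ * k (‖v.1‖⁻¹ • v.1)
            ∂(volume.comap Subtype.val) := by
          rw [integral_subtype_comap (measurableSet_singleton _).compl
            fun v : Vec d => φ ‖v‖ * k (‖v‖⁻¹ • v), restrict_compl_singleton]
      _ = ∫ q, k q.1 * φ q.2 ∂(volume : Measure (Vec d)).toSphere.prod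
            (.volumeIoiPow (finrank ℝ (Vec d) - 1)) := by
          rw [← (volume : Measure (Vec d)).measurePreserving_homeomorphUnitSphereProd.integral_comp
            (Homeomorph.measurableEmbedding _)]
          refine integral_congr_ae (.of_forall fun v => ?_)
          simp [mul_comm]
      _ = _ := integral_prod_mul (fun u : sphere (0 : Vec d) 1 => k u)
            (fun r : Ioi (0 : ℝ) => φ r)
  have hpos : (volume : Measure (Vec d)).toSphere.real univ ≠ 0 := by
    rw [Measure.toSphere_real_apply_univ]
    have : 0 < volume.real (ball (0 : Vec d) 1) :=
      ENNReal.toReal_pos (measure_ball_pos _ _ one_pos).ne' measure_ball_lt_top.ne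
    have hfr : finrank ℝ (Vec d) ≠ 0 := by simp; omega
    positivity
  -- The constant function identifies the radial factor, so it need not be computed.
  have h1 := key fun _ => 1
  simp only [mul_one, integral_const, smul_eq_mul] at h1
  rw [key h, integral_uniformSphere, h1]
  field_simp

theorem hasLineDerivAt_norm {v : Vec d} (hv : v ≠ 0) (w : Vec d) :
    HasLineDerivAt ℝ (fun x : Vec d => ‖x‖) (inner ℝ (‖v‖⁻¹ • v) w) v w := by
  have h := ((hasStrictFDerivAt_norm_sq v).hasFDerivAt.sqrt
    (pow_ne_zero 2 (norm_ne_zero_iff.2 hv))).hasLineDerivAt w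
  simp only [Real.sqrt_sq (norm_nonneg _)] at h
  have e : inner ℝ (‖v‖⁻¹ • v) w = ((1 / (2 * ‖v‖)) • 2 • (innerSL ℝ) v) w := by
    simp only [real_inner_smul_left, smul_apply, innerSL_apply_apply, smul_eq_mul,
      nsmul_eq_mul, Nat.cast_ofNat]
    field_simp
  rw [e]
  exact h

/-- The radial cutoff equal to `1` on the ball of radius `1 - δ` and to `0` off the unit ball. -/
noncomputable def cutoff (δ : ℝ) (v : Vec d) : ℝ := min 1 (max 0 (δ⁻¹ * (1 - ‖v‖)))

theorem cutoff_mem_Icc (δ : ℝ) (v : Vec d) : cutoff δ v ∈ Icc (0 : ℝ) 1 :=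
  ⟨le_min zero_le_one (le_max_left _ _), min_le_left _ _⟩

theorem cutoff_eq_zero {δ : ℝ} (hδ : 0 < δ) {v : Vec d} (hv : 1 ≤ ‖v‖) : cutoff δ v = 0 := by
  have : δ⁻¹ * (1 - ‖v‖) ≤ 0 := mul_nonpos_of_nonneg_of_nonpos (by positivity) (by linarith)
  rw [cutoff, max_eq_left this]
  simp

theorem cutoff_eq_one {δ : ℝ} (hδ : 0 < δ) {v : Vec d} (hv : ‖v‖ ≤ 1 - δ) : cutoff δ v = 1 := by
  have : 1 ≤ δ⁻¹ * (1 - ‖v‖) := by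
    rw [inv_mul_eq_div, le_div_iff₀ hδ]
    linarith
  rw [cutoff, min_eq_left (this.trans (le_max_right _ _))]

theorem lipschitzWith_cutoff {δ : ℝ} (hδ : 0 < δ) :
    LipschitzWith ⟨δ⁻¹, (inv_pos.2 hδ).le⟩ (cutoff (d := d) δ) := by
  have h : LipschitzWith ⟨δ⁻¹, (inv_pos.2 hδ).le⟩ fun v : Vec d => δ⁻¹ * (1 - ‖v‖) := by
    refine LipschitzWith.of_dist_le_mul fun v w => ?_
    rw [Real.dist_eq, ← mul_sub, abs_mul, abs_of_pos (inv_pos.2 hδ), sub_sub_sub_cancel_left,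
      abs_sub_comm, dist_eq_norm]
    exact mul_le_mul_of_nonneg_left (abs_norm_sub_norm_le v w) (inv_pos.2 hδ).le
  exact (h.const_max 0).const_min 1

theorem hasCompactSupport_cutoff {δ : ℝ} (hδ : 0 < δ) :
    HasCompactSupport (cutoff (d := d) δ) := by
  refine HasCompactSupport.intro (isCompact_closedBall (0 : Vec d) 1) fun v hv => ?_
  exact cutoff_eq_zero hδ (by simpa using (not_le.1 (by simpa using hv)).le)

theorem integrable_cutoff {δ : ℝ} (hδ : 0 < δ) : Integrable (cutoff (d := d) δ) :=
  (lipschitzWith_cutoff hδ).continuous.integrable_of_hasCompactSupport (hasCompactSupport_cutoff hδ)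

/-- Off the two excluded spheres, which are null sets, the cutoff is locally constant or affine in
the norm. The direction `-w` is the one produced by integration by parts. -/
theorem lineDeriv_cutoff_neg {δ : ℝ} (hδ : 0 < δ) (hδ1 : δ < 1) {v : Vec d} (w : Vec d)
    (h1 : ‖v‖ ≠ 1) (h2 : ‖v‖ ≠ 1 - δ) :
    lineDeriv ℝ (cutoff δ) v (-w)
      = {r : ℝ | 1 - δ < r ∧ r < 1}.indicator (fun _ => δ⁻¹) ‖v‖ * inner ℝ (‖v‖⁻¹ • v) w := by
  have hcont : Continuous fun x : Vec d => ‖x‖ := continuous_norm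
  have hconst : ∀ c : ℝ, cutoff δ =ᶠ[𝓝 v] (fun _ => c) → lineDeriv ℝ (cutoff δ) v (-w) = 0 :=
    fun c hc => by rw [hc.lineDeriv_eq]; simp [lineDeriv]
  rcases lt_or_gt_of_ne h1 with h1 | h1
  · rcases lt_or_gt_of_ne h2 with h2 | h2
    · rw [hconst 1, indicator_of_notMem (by simp [h2.le]), zero_mul]
      filter_upwards [hcont.continuousAt.eventually_lt_const h2] with x hx
      exact cutoff_eq_one hδ hx.le
    · rw [indicator_of_mem (show ‖v‖ ∈ {r : ℝ | 1 - δ < r ∧ r < 1} from ⟨h2, h1⟩)]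
      have hv : v ≠ 0 := norm_ne_zero_iff.1 (by linarith)
      have heq : cutoff δ =ᶠ[𝓝 v] fun x => δ⁻¹ * (1 - ‖x‖) := by
        filter_upwards [hcont.continuousAt.eventually_lt_const h1,
          hcont.continuousAt.eventually_const_lt h2] with x hx1 hx2
        have ha : 0 ≤ δ⁻¹ * (1 - ‖x‖) := mul_nonneg (inv_pos.2 hδ).le (by linarith)
        have hb : δ⁻¹ * (1 - ‖x‖) ≤ 1 := by
          rw [inv_mul_eq_div, div_le_one hδ]
          linarith
        rw [cutoff, max_eq_right ha, min_eq_right hb]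
      rw [heq.lineDeriv_eq]
      have hd := hasLineDerivAt_norm hv (-w)
      unfold HasLineDerivAt at hd
      have hd2 := (hd.const_sub 1).const_mul δ⁻¹
      have hd3 : HasLineDerivAt ℝ (fun x : Vec d => δ⁻¹ * (1 - ‖x‖))
        (δ⁻¹ * -inner ℝ (‖v‖⁻¹ • v) (-w)) v (-w) := hd2
      rw [hd3.lineDeriv, inner_neg_right, neg_neg]
  · rw [hconst 0, indicator_of_notMem (by simp [h1.le]), zero_mul]
    filter_upwards [hcont.continuousAt.eventually_const_lt h1] with x hx
    exact cutoff_eq_zero hδ hx.le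

theorem abs_inner_direction_le (v w : Vec d) : |inner ℝ (‖v‖⁻¹ • v) w| ≤ ‖w‖ := by
  refine (abs_real_inner_le_norm _ _).trans ?_
  rw [norm_smul, norm_inv, norm_norm]
  exact mul_le_of_le_one_left (norm_nonneg _) (inv_mul_le_one (a := ‖v‖))

theorem integrable_annulus (δ : ℝ) :
    Integrable fun v : Vec d => {r : ℝ | 1 - δ < r ∧ r < 1}.indicator (fun _ => δ⁻¹) ‖v‖ := by
  have hs : MeasurableSet {v : Vec d | 1 - δ < ‖v‖ ∧ ‖v‖ < 1} :=
    (measurableSet_lt measurable_const measurable_norm).inter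
      (measurableSet_lt measurable_norm measurable_const)
  have : IntegrableOn (fun _ : Vec d => δ⁻¹) {v : Vec d | 1 - δ < ‖v‖ ∧ ‖v‖ < 1} :=
    integrableOn_const ((measure_mono (t := ball (0 : Vec d) 1) fun v hv => by
      simpa using hv.2).trans_lt measure_ball_lt_top).ne
  exact (integrable_indicator_iff hs).2 this

theorem integral_annulus {δ : ℝ} (hδ : 0 < δ) (hδ1 : δ < 1) :
    ∫ v : Vec d, {r : ℝ | 1 - δ < r ∧ r < 1}.indicator (fun _ => δ⁻¹) ‖v‖
      = δ⁻¹ * (1 - (1 - δ) ^ d) * volume.real (ball (0 : Vec d) 1) := by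
  have hs : ball (0 : Vec d) 1 \ closedBall 0 (1 - δ) = {v : Vec d | 1 - δ < ‖v‖ ∧ ‖v‖ < 1} := by
    ext v; simp [and_comm]
  have hm : MeasurableSet (ball (0 : Vec d) 1 \ closedBall 0 (1 - δ)) :=
    measurableSet_ball.diff measurableSet_closedBall
  calc ∫ v : Vec d, {r : ℝ | 1 - δ < r ∧ r < 1}.indicator (fun _ => δ⁻¹) ‖v‖
      = ∫ v, (ball (0 : Vec d) 1 \ closedBall 0 (1 - δ)).indicator (fun _ => δ⁻¹) v := by
        rw [hs]; rfl
    _ = volume.real (ball (0 : Vec d) 1 \ closedBall 0 (1 - δ)) * δ⁻¹ := by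
        rw [integral_indicator hm, setIntegral_const, smul_eq_mul]
    _ = _ := by
        rw [measureReal_sdiff (closedBall_subset_ball (by linarith)) measurableSet_closedBall,
          Measure.addHaar_real_closedBall _ _ (by linarith)]
        simp
        ring

/-- A form of the divergence theorem on the unit ball: a lower bound on a directional derivative of
a Lipschitz function gives a lower bound on its flux through the unit sphere. -/
theorem le_integral_uniformSphere_of_le_lineDeriv (hd : 1 ≤ d) {f : Vec d → ℝ} {L : NNReal}
    (hf : LipschitzWith L f) (w : Vec d) {K : ℝ}
    (hK : ∀ v ∈ ball (0 : Vec d) 1, K ≤ lineDeriv ℝ f v w) :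
    K ≤ d * ∫ u, f u * inner ℝ u w ∂uniformSphere d := by
  have := nontrivial_vec hd
  set m := ∫ u, f u * inner ℝ u w ∂uniformSphere d
  set V := volume.real (ball (0 : Vec d) 1)
  have hV : 0 < V := ENNReal.toReal_pos (measure_ball_pos _ _ one_pos).ne' measure_ball_lt_top.ne
  have hbound : ∀ δ : ℝ, 0 < δ → δ < 1 → K * ∫ v : Vec d, cutoff δ v
      ≤ δ⁻¹ * (1 - (1 - δ) ^ d) * V * (m + L * ‖w‖ * δ) := by
    intro δ hδ hδ1
    set φ : ℝ → ℝ := {r : ℝ | 1 - δ < r ∧ r < 1}.indicator (fun _ => δ⁻¹) with hφ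
    have hφ0 : ∀ r, 0 ≤ φ r := indicator_nonneg fun _ _ => (inv_pos.2 hδ).le
    have hφs : ∀ r, ¬ (1 - δ < r ∧ r < 1) → φ r = 0 := fun r hr => indicator_of_notMem (s := {r : ℝ | 1 - δ < r ∧ r < 1}) hr _
    have hφi : Integrable fun v : Vec d => φ ‖v‖ := integrable_annulus δ
    have hdirm : Measurable fun v : Vec d => ‖v‖⁻¹ • v := measurable_norm.inv.smul measurable_id
    have hinm : Measurable fun v : Vec d => inner ℝ (‖v‖⁻¹ • v) w :=
      hdirm.inner measurable_const
    obtain ⟨M, hM⟩ := (isCompact_closedBall (0 : Vec d) 1).exists_bound_of_continuousOn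
      hf.continuous.continuousOn
    have hM0 : 0 ≤ M := (norm_nonneg _).trans (hM 0 (by simp))
    have hdir1 : ∀ v : Vec d, ‖v‖⁻¹ • v ∈ closedBall (0 : Vec d) 1 := fun v => by
      rw [mem_closedBall_zero_iff, norm_smul, norm_inv, norm_norm]
      exact inv_mul_le_one
    have hL1 : K * ∫ v : Vec d, cutoff δ v ≤ ∫ v, lineDeriv ℝ f v w * cutoff δ v := by
      rw [← integral_const_mul]
      refine integral_mono ((integrable_cutoff hδ).const_mul K) ?_ fun v => ?_
      · refine (integrable_cutoff hδ).bdd_mul (c := L * ‖w‖)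
          (measurable_lineDeriv hf.continuous).aestronglyMeasurable (.of_forall fun v => ?_)
        exact norm_lineDeriv_le_of_lipschitz ℝ hf
      · by_cases hv : v ∈ ball (0 : Vec d) 1
        · exact mul_le_mul_of_nonneg_right (hK v hv) (cutoff_mem_Icc δ v).1
        · simp only [cutoff_eq_zero hδ (by simpa using hv), mul_zero, le_refl]
    have hL2 : ∫ v, lineDeriv ℝ f v w * cutoff δ v
        = ∫ v : Vec d, φ ‖v‖ * (inner ℝ (‖v‖⁻¹ • v) w * f v) := by
      rw [hf.integral_lineDeriv_mul_eq (lipschitzWith_cutoff hδ) (hasCompactSupport_cutoff hδ)]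
      refine integral_congr_ae ?_
      have hs : ∀ r : ℝ, r ≠ 0 → ∀ᵐ v : Vec d, ‖v‖ ≠ r := fun r hr => by
        have := Measure.addHaar_sphere_of_ne_zero (volume : Measure (Vec d)) 0 hr
        filter_upwards [compl_mem_ae_iff.2 this] with v hv
        simpa using hv
      filter_upwards [hs 1 one_ne_zero, hs (1 - δ) (by linarith)] with v h1 h2
      rw [lineDeriv_cutoff_neg hδ hδ1 w h1 h2, mul_assoc]
    have hi1 : Integrable fun v : Vec d =>
        φ ‖v‖ * (f (‖v‖⁻¹ • v) * inner ℝ (‖v‖⁻¹ • v) w) := by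
      refine hφi.mul_bdd (c := M * ‖w‖)
        ((hf.continuous.measurable.comp hdirm).mul hinm).aestronglyMeasurable
        (.of_forall fun v => ?_)
      rw [norm_mul]
      exact mul_le_mul (hM _ (hdir1 v)) (abs_inner_direction_le v w) (norm_nonneg _) hM0
    -- On the annulus `v` is within `δ` of its radial projection to the sphere, so replacing `f v`
    -- by the boundary value costs at most `L ‖w‖ δ`; the integrand then splits into direction and
    -- norm.
    have hL3 : ∫ v : Vec d, φ ‖v‖ * (inner ℝ (‖v‖⁻¹ • v) w * f v)
        ≤ ∫ v : Vec d, (φ ‖v‖ * (f (‖v‖⁻¹ • v) * inner ℝ (‖v‖⁻¹ • v) w)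
            + φ ‖v‖ * (L * ‖w‖ * δ)) := by
      refine integral_mono ?_ (hi1.add (hφi.mul_const _)) fun v => ?_
      · refine (hφi.mul_const (‖w‖ * M)).mono' (hφi.aestronglyMeasurable.mul
          (hinm.mul hf.continuous.measurable).aestronglyMeasurable) (.of_forall fun v => ?_)
        by_cases hv : 1 - δ < ‖v‖ ∧ ‖v‖ < 1
        · rw [norm_mul, norm_mul, Real.norm_of_nonneg (hφ0 _)]
          have := hM v (by simpa using hv.2.le)
          have := abs_inner_direction_le v w
          have := hφ0 ‖v‖
          rw [Real.norm_eq_abs (inner ℝ _ _)]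
          gcongr
        · simp [hφs _ hv]
      · by_cases hv : 1 - δ < ‖v‖ ∧ ‖v‖ < 1
        · simp only [← mul_add]
          refine mul_le_mul_of_nonneg_left ?_ (hφ0 _)
          have hv0 : 0 < ‖v‖ := by linarith
          have h1 : ‖v - ‖v‖⁻¹ • v‖ ≤ δ := by
            have : v - ‖v‖⁻¹ • v = (1 - ‖v‖⁻¹) • v := by rw [sub_smul, one_smul]
            rw [this, norm_smul, ← Real.norm_of_nonneg hv0.le, ← norm_mul, norm_norm, sub_mul,
              inv_mul_cancel₀ hv0.ne', Real.norm_eq_abs, abs_le]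
            constructor <;> linarith
          have h2 : |f v - f (‖v‖⁻¹ • v)| ≤ L * δ := by
            refine (hf.dist_le_mul v (‖v‖⁻¹ • v)).trans ?_
            rw [dist_eq_norm]
            gcongr
          have h3 := abs_inner_direction_le v w
          have h4 : (f v - f (‖v‖⁻¹ • v)) * inner ℝ (‖v‖⁻¹ • v) w ≤ L * δ * ‖w‖ := by
            refine (le_abs_self _).trans ?_
            rw [abs_mul]
            gcongr
          linarith
        · simp [hφs _ hv]
    rw [integral_add hi1 (hφi.mul_const _), integral_mul_const,
      integral_direction_mul_norm hd (fun u => f u * inner ℝ u w) φ, ← mul_add,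
      integral_annulus hδ hδ1] at hL3
    linarith
  have hmem : Ioo (0 : ℝ) 1 ∈ 𝓝[>] (0 : ℝ) := Ioo_mem_nhdsGT one_pos
  have hid : Tendsto (fun δ : ℝ => δ) (𝓝[>] 0) (𝓝 0) := nhdsWithin_le_nhds
  have hlim1 : Tendsto (fun δ : ℝ => ∫ v : Vec d, cutoff δ v) (𝓝[>] 0) (𝓝 V) := by
    have hlow : Tendsto (fun δ : ℝ => (1 - δ) ^ d * V) (𝓝[>] 0) (𝓝 V) := by
      have := ((hid.const_sub 1).pow d).mul_const V
      simpa using this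
    refine tendsto_of_tendsto_of_tendsto_of_le_of_le' hlow tendsto_const_nhds ?_ ?_
    · filter_upwards [hmem] with δ hδ
      have hi : IntegrableOn (fun _ : Vec d => (1 : ℝ)) (closedBall 0 (1 - δ)) :=
        integrableOn_const measure_closedBall_lt_top.ne
      calc (1 - δ) ^ d * V = volume.real (closedBall (0 : Vec d) (1 - δ)) := by
            rw [Measure.addHaar_real_closedBall _ _ (by linarith [hδ.2])]
            simp [V]
        _ = ∫ v, (closedBall (0 : Vec d) (1 - δ)).indicator (fun _ => (1 : ℝ)) v := by
            rw [integral_indicator measurableSet_closedBall, setIntegral_const, smul_eq_mul,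
              mul_one]
        _ ≤ _ := by
            refine integral_mono ((integrable_indicator_iff measurableSet_closedBall).2 hi)
              (integrable_cutoff hδ.1) fun v => ?_
            by_cases hv : v ∈ closedBall (0 : Vec d) (1 - δ)
            · rw [indicator_of_mem hv]
              exact (cutoff_eq_one hδ.1 (by simpa using hv)).ge
            · rw [indicator_of_notMem hv]
              exact (cutoff_mem_Icc δ v).1
    · filter_upwards [hmem] with δ hδ
      have hi : IntegrableOn (fun _ : Vec d => (1 : ℝ)) (ball 0 1) :=
        integrableOn_const measure_ball_lt_top.ne
      calc ∫ v : Vec d, cutoff δ v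
          ≤ ∫ v, (ball (0 : Vec d) 1).indicator (fun _ => (1 : ℝ)) v := by
            refine integral_mono (integrable_cutoff hδ.1)
              ((integrable_indicator_iff measurableSet_ball).2 hi) fun v => ?_
            by_cases hv : v ∈ ball (0 : Vec d) 1
            · rw [indicator_of_mem hv]
              exact (cutoff_mem_Icc δ v).2
            · rw [indicator_of_notMem hv]
              exact (cutoff_eq_zero hδ.1 (by simpa using hv)).le
        _ = V := by
            rw [integral_indicator measurableSet_ball, setIntegral_const, smul_eq_mul, mul_one]
  -- This is the derivative of `1 - (1-δ)^d` at `0`; it produces the dimension factor of the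
  -- estimator.
  have hlim2 : Tendsto (fun δ : ℝ => δ⁻¹ * (1 - (1 - δ) ^ d)) (𝓝[>] 0) (𝓝 d) := by
    have h := (((hasDerivAt_id (0 : ℝ)).const_sub 1).pow d).const_sub 1
    have h2 := (hasDerivAt_iff_tendsto_slope_zero.1 h).mono_left
      (nhdsWithin_mono 0 fun x (hx : x ∈ Ioi (0 : ℝ)) => ne_of_gt hx)
    simpa using h2
  have hlim3 := ((hlim2.mul_const V).mul ((hid.const_mul (L * ‖w‖)).const_add m))
  have hle := le_of_tendsto_of_tendsto (hlim1.const_mul K) hlim3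
    (by filter_upwards [hmem] with δ hδ using hbound δ hδ.1 hδ.2)
  rw [mul_zero, add_zero] at hle
  refine le_of_mul_le_mul_right ?_ hV
  linarith

end

end DOCO

/-! ### First-order convexity, the one-point estimator, and projected averaging -/

namespace DOCO

open Finset

section

variable {d N p : ℕ}

theorem inner_gradient {f : Vec d → ℝ} {x : Vec d} (hf : DifferentiableAt ℝ f x) (w : Vec d) :
    inner ℝ (gradient f x) w = fderiv ℝ f x w := by
  rw [hf.hasGradientAt.hasFDerivAt.fderiv]
  simp

theorem norm_fderiv_eq_norm_gradient {f : Vec d → ℝ} {x : Vec d} :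
    ‖fderiv ℝ f x‖ = ‖gradient f x‖ := by
  simp [gradient]

/-- The first-order characterization of convexity. -/
theorem add_inner_gradient_le {f : Vec d → ℝ} (hf : ConvexOn ℝ Set.univ f) {x : Vec d}
    (hx : DifferentiableAt ℝ f x) (y : Vec d) :
    f x + inner ℝ (gradient f x) (y - x) ≤ f y := by
  have hconv : ConvexOn ℝ Set.univ (f ∘ AffineMap.lineMap (k := ℝ) x y) := by
    simpa using hf.comp_affineMap (AffineMap.lineMap (k := ℝ) x y)
  have hder : HasDerivAt (f ∘ AffineMap.lineMap (k := ℝ) x y)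
      (inner ℝ (gradient f x) (y - x)) 0 := by
    rw [inner_gradient hx]
    have h1 : HasDerivAt (AffineMap.lineMap (k := ℝ) x y) (y - x) (0 : ℝ) :=
      AffineMap.hasDerivAt_lineMap
    have h2 : HasFDerivAt f (fderiv ℝ f x) (AffineMap.lineMap (k := ℝ) x y (0 : ℝ)) := by
      simpa using hx.hasFDerivAt
    exact h2.comp_hasDerivAt 0 h1
  have h := hconv.le_slope_of_hasDerivAt (Set.mem_univ 0) (Set.mem_univ 1) one_pos hder
  simp [slope] at h
  rw [inner_gradient hx, map_sub]
  linarith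

theorem continuous_of_convexOn {f : Vec d → ℝ} (hf : ConvexOn ℝ Set.univ f) : Continuous f :=
  continuousOn_univ.1 (hf.continuousOn isOpen_univ)

/-- A directional lower bound on the gradient over a ball of radius `ε` bounds the expectation of
the one-point gradient estimator from below. -/
theorem le_integral_onePointGrad (hd : 1 ≤ d) {f : Vec d → ℝ} {R G ε K : ℝ}
    (hf : ∀ x ∈ Ball d R, DifferentiableAt ℝ f x ∧ ‖gradient f x‖ ≤ G) (hG : 0 ≤ G) (hε : 0 < ε)
    {x : Vec d} (hx : ‖x‖ ≤ R - ε) (w : Vec d)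
    (hK : ∀ v : Vec d, ‖v‖ ≤ 1 → K ≤ inner ℝ (gradient f (x + ε • v)) w) :
    K ≤ ∫ u, inner ℝ (onePointGrad f ε x u) w ∂uniformSphere d := by
  have hmem : ∀ v : Vec d, ‖v‖ ≤ 1 → x + ε • v ∈ Ball d R := fun v hv => by
    rw [mem_closedBall_zero_iff]
    refine (norm_add_le _ _).trans ?_
    rw [norm_smul, Real.norm_of_nonneg hε.le]
    nlinarith
  have hder : ∀ v : Vec d, ‖v‖ ≤ 1 →
      HasFDerivAt (fun v => f (x + ε • v)) (ε • fderiv ℝ f (x + ε • v)) v := by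
    intro v hv
    have h1 : HasFDerivAt (fun v : Vec d => x + ε • v)
        (ε • ContinuousLinearMap.id ℝ (Vec d)) v :=
      ((hasFDerivAt_id v).const_smul ε).const_add x
    have h2 := (hf _ (hmem v hv)).1.hasFDerivAt.comp v h1
    rwa [ContinuousLinearMap.comp_smul, ContinuousLinearMap.comp_id] at h2
  have hlip : LipschitzOnWith (Real.toNNReal (ε * G)) (fun v => f (x + ε • v))
      (Metric.closedBall (0 : Vec d) 1) := by
    refine (convex_closedBall _ _).lipschitzOnWith_of_nnnorm_hasFDerivWithin_le
      (fun v hv => (hder v (by simpa using hv)).hasFDerivWithinAt) fun v hv => ?_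
    rw [← NNReal.coe_le_coe, coe_nnnorm, Real.coe_toNNReal _ (by positivity), norm_smul, Real.norm_of_nonneg hε.le,
      norm_fderiv_eq_norm_gradient]
    exact mul_le_mul_of_nonneg_left (hf _ (hmem v (by simpa using hv))).2 hε.le
  -- The divergence inequality wants a globally Lipschitz function. The extension agrees on the
  -- closed unit ball, hence also on the sphere where the estimator samples.
  obtain ⟨g, hg, hfg⟩ := hlip.extend_real
  have hkey := le_integral_uniformSphere_of_le_lineDeriv hd hg w (K := ε * K) fun v hv => by
    have heq : g =ᶠ[nhds v] fun v => f (x + ε • v) := by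
      filter_upwards [Metric.isOpen_ball.mem_nhds hv] with v' hv'
      exact (hfg (Metric.ball_subset_closedBall hv')).symm
    have hv1 : ‖v‖ ≤ 1 := by simpa using (mem_ball_zero_iff.1 hv).le
    rw [heq.lineDeriv_eq, ((hder v hv1).hasLineDerivAt w).lineDeriv]
    simp only [smul_apply, smul_eq_mul]
    rw [← inner_gradient (hf _ (hmem v hv1)).1]
    exact mul_le_mul_of_nonneg_left (hK v hv1) hε.le
  have h_int : ∫ u, inner ℝ (onePointGrad f ε x u) w ∂uniformSphere d
      = d / ε * ∫ u, g u * inner ℝ u w ∂uniformSphere d := by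
    rw [← MeasureTheory.integral_const_mul]
    refine MeasureTheory.integral_congr_ae ?_
    filter_upwards [ae_norm_eq_one_uniformSphere] with u hu
    have : f (x + ε • u) = g u := hfg (by simp [hu])
    rw [onePointGrad, real_inner_smul_left, this, mul_assoc]
  rw [h_int, div_mul_eq_mul_div, le_div_iff₀ hε, mul_comm]
  exact hkey

/-- Projection onto a ball brings points closer to every point of the ball. -/
theorem norm_projBall_sub_le {r : ℝ} (hr : 0 ≤ r) (x : Vec d) {z : Vec d} (hz : ‖z‖ ≤ r) :
    ‖projBall r x - z‖ ≤ ‖x - z‖ := by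
  unfold projBall
  split_ifs with h
  · exact le_rfl
  · have hx : 0 < ‖x‖ := lt_of_le_of_lt hr (not_le.1 h)
    refine abs_le_of_sq_le_sq' ?_ (norm_nonneg _) |>.2
    rw [norm_sub_sq_real, norm_sub_sq_real, norm_smul, real_inner_smul_left, norm_div, norm_norm,
      Real.norm_of_nonneg hr, div_mul_cancel₀ _ hx.ne']
    have h1 : inner ℝ x z ≤ ‖x‖ * r :=
      (real_inner_le_norm x z).trans (mul_le_mul_of_nonneg_left hz hx.le)
    have h2 : 0 ≤ 1 - r / ‖x‖ := sub_nonneg.2 ((div_le_one hx).2 (not_le.1 h).le)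
    have h3 : (1 - r / ‖x‖) * inner ℝ x z ≤ (1 - r / ‖x‖) * (‖x‖ * r) :=
      mul_le_mul_of_nonneg_left h1 h2
    have h4 : (1 - r / ‖x‖) * (‖x‖ * r) = ‖x‖ * r - r ^ 2 := by field_simp
    nlinarith [sq_nonneg (‖x‖ - r)]

theorem norm_average_le {A : Matrix (Fin N) (Fin N) ℝ} (hA : A ∈ doublyStochastic ℝ (Fin N))
    {X : Fin N → Vec d} {r : ℝ} (hX : ∀ j, ‖X j‖ ≤ r) (i : Fin N) : ‖average A X i‖ ≤ r := by
  obtain ⟨hnn, hr, -⟩ := mem_doublyStochastic_iff_sum.1 hA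
  calc ‖average A X i‖ ≤ ∑ j, ‖A i j • X j‖ := norm_sum_le _ _
    _ ≤ ∑ j, A i j * r := sum_le_sum fun j _ => by
        rw [norm_smul, Real.norm_of_nonneg (hnn i j)]
        exact mul_le_mul_of_nonneg_left (hX j) (hnn i j)
    _ = r := by rw [← sum_mul, hr, one_mul]

/-- Jensen's inequality for the squared norm uses the row sums; summing over the units uses the
column sums. -/
theorem sum_sq_projBall_average_le {A : Matrix (Fin N) (Fin N) ℝ}
    (hA : A ∈ doublyStochastic ℝ (Fin N)) {r : ℝ} (hr : 0 ≤ r) (Y : Fin N → Vec d) {z : Vec d}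
    (hz : ‖z‖ ≤ r) :
    ∑ i, ‖projBall r (average A Y i) - z‖ ^ 2 ≤ ∑ j, ‖Y j - z‖ ^ 2 := by
  obtain ⟨hnn, hrow, hcol⟩ := mem_doublyStochastic_iff_sum.1 hA
  have h : ∀ i, ‖projBall r (average A Y i) - z‖ ^ 2 ≤ ∑ j, A i j * ‖Y j - z‖ ^ 2 := by
    intro i
    have h1 : average A Y i - z = ∑ j, A i j • (Y j - z) := by
      simp_rw [smul_sub, sum_sub_distrib, ← sum_smul, hrow, one_smul]
      rfl
    have h2 := (convexOn_univ_norm (E := Vec d)).pow (fun _ _ => norm_nonneg _) 2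
    have h3 := h2.map_sum_le (t := univ) (w := fun j => A i j) (p := fun j => Y j - z)
      (fun j _ => hnn i j) (hrow i) fun _ _ => Set.mem_univ _
    rw [← h1] at h3
    refine le_trans ?_ h3
    simp only [Pi.pow_apply]
    gcongr
    exact norm_projBall_sub_le hr _ hz
  refine (sum_le_sum fun i _ => h i).trans ?_
  rw [sum_comm]
  simp_rw [← sum_mul, hcol, one_mul, le_refl]

/-- The average of `X` already lies in the ball, so projecting only brings the averaged `Y` nearer
to it. This bounds the perturbation fed into the consensus estimate by the local step lengths. -/
theorem sum_norm_projBall_average_sub_le {A : Matrix (Fin N) (Fin N) ℝ}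
    (hA : A ∈ doublyStochastic ℝ (Fin N)) {r : ℝ} (hr : 0 ≤ r) {X : Fin N → Vec d}
    (hX : ∀ j, ‖X j‖ ≤ r) (Y : Fin N → Vec d) :
    ∑ i, ‖projBall r (average A Y i) - average A X i‖ ≤ ∑ j, ‖Y j - X j‖ := by
  obtain ⟨hnn, hrow, hcol⟩ := mem_doublyStochastic_iff_sum.1 hA
  have h : ∀ i, ‖projBall r (average A Y i) - average A X i‖ ≤ ∑ j, A i j * ‖Y j - X j‖ := by
    intro i
    refine (norm_projBall_sub_le hr _ (norm_average_le hA hX i)).trans ?_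
    unfold average
    rw [← sum_sub_distrib]
    refine (norm_sum_le _ _).trans (sum_le_sum fun j _ => ?_)
    rw [← smul_sub, norm_smul, Real.norm_of_nonneg (hnn i j)]
  refine (sum_le_sum fun i _ => h i).trans ?_
  rw [sum_comm]
  simp_rw [← sum_mul, hcol, one_mul, le_refl]

end

end DOCO

/-! ### Pathwise descent and disagreement along a trajectory -/

namespace DOCO

open Finset

/-- Convexity, differentiability and boundedness of losses and constraints over the ball of
radius `R`, with a common positive bound `G` on the gradients. -/
structure Problem.Regular {d N p : ℕ} (P : Problem d N p) (T : ℕ) (R G σ C : ℝ) : Prop where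
  p_pos : 1 ≤ p
  G_pos : 0 < G
  σ_pos : 0 < σ
  loss_convex : ∀ t ∈ Icc 1 T, ∀ i, ConvexOn ℝ Set.univ (P.loss t i)
  loss_grad : ∀ t ∈ Icc 1 T, ∀ i, ∀ x ∈ Ball d R,
    DifferentiableAt ℝ (P.loss t i) x ∧ ‖gradient (P.loss t i) x‖ ≤ G
  loss_strong : ∀ t ∈ Icc 1 T, ∀ i, ∀ x ∈ Ball d R, ∀ y ∈ Ball d R,
    P.loss t i y + inner ℝ (gradient (P.loss t i) y) (x - y) + σ / 2 * ‖x - y‖ ^ 2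
      ≤ P.loss t i x
  loss_bound : ∀ t ∈ Icc 1 T, ∀ i, ∀ x ∈ Ball d R, |P.loss t i x| ≤ C
  con_convex : ∀ s, ConvexOn ℝ Set.univ (P.con s)
  con_grad : ∀ s, ∀ x ∈ Ball d R, DifferentiableAt ℝ (P.con s) x ∧ ‖gradient (P.con s) x‖ ≤ G
  con_zero : ∀ s, P.con s 0 ≤ 0

/-- The states of the algorithm with the step sizes for strongly convex losses and exploration
parameter `ε`. -/
noncomputable def trajectory {d N p : ℕ} (P : Problem d N p) (R G σ ε : ℝ)
    (u : ℕ → Fin N → Vec d) : ℕ → State d N p :=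
  run P (fun t => 1 / (σ * t)) (fun t => 2 * p * G ^ 2 / (σ * t)) (fun _ => ε) (R - ε) u

section

variable {d N p : ℕ} {P : Problem d N p} {T : ℕ} {R G σ C ε : ℝ}

theorem trajectory_one (u : ℕ → Fin N → Vec d) : trajectory P R G σ ε u 1 = (0, 0) := rfl

theorem trajectory_succ (u : ℕ → Fin N → Vec d) {t : ℕ} (ht : 1 ≤ t) (i : Fin N) :
    (trajectory P R G σ ε u (t + 1)).1 i = projBall (R - ε) (average (P.weight t)
      (intermediate P t (1 / (σ * t)) ε (u t) (trajectory P R G σ ε u t)) i) := by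
  obtain ⟨t, rfl⟩ := Nat.exists_eq_add_of_le' ht
  rfl

theorem norm_trajectory_le (hεR : ε ≤ R) (u : ℕ → Fin N → Vec d) (t : ℕ) (i : Fin N) :
    ‖(trajectory P R G σ ε u t).1 i‖ ≤ R - ε := by
  match t with
  | 0 => simpa [trajectory, run] using hεR
  | 1 => simpa [trajectory, run] using hεR
  | t + 2 =>
    rw [trajectory_succ u (by omega : 1 ≤ t + 1)]
    simpa using projBall_mem (sub_nonneg.2 hεR) _

/-- The dual variable of round `t` was computed with `η_{t-1}`, hence the factor `t - 1`; at `t = 1`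
this factor vanishes, in agreement with the zero initialization. -/
theorem trajectory_dual (u : ℕ → Fin N → Vec d) {t : ℕ} (ht : 1 ≤ t)
    (i : Fin N) (s : Fin p) : (trajectory P R G σ ε u t).2 i s
      = σ * (t - 1) / (2 * p * G ^ 2) * max (P.con s ((trajectory P R G σ ε u t).1 i)) 0 := by
  match t, ht with
  | 1, _ => simp [trajectory_one]
  | t + 2, _ =>
    have : (trajectory P R G σ ε u (t + 2)).2 i
      = dualStep P.con (2 * p * G ^ 2 / (σ * (t + 1 : ℕ))) ((trajectory P R G σ ε u (t + 2)).1 i) :=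
      rfl
    rw [this, dualStep]
    simp only [div_div_eq_mul_div]
    push_cast
    ring

/-- The penalty part of the descent direction of unit `i`. -/
noncomputable def penalty (P : Problem d N p) (S : State d N p) (i : Fin N) : Vec d :=
  ∑ s, (S.2 i) s • posPartGrad (P.con s) (S.1 i)

theorem norm_onePointGrad_le (H : P.Regular T R G σ C) (hε : 0 < ε) {t : ℕ} (ht : t ∈ Icc 1 T)
    {i : Fin N} {x u : Vec d} (hx : ‖x‖ ≤ R - ε) (hu : ‖u‖ = 1) :
    ‖onePointGrad (P.loss t i) ε x u‖ ≤ d * C / ε := by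
  have hmem : x + ε • u ∈ Ball d R := by
    rw [mem_closedBall_zero_iff]
    refine (norm_add_le _ _).trans ?_
    rw [norm_smul, Real.norm_of_nonneg hε.le, hu]
    linarith
  rw [onePointGrad, norm_smul, hu, mul_one, norm_mul, Real.norm_eq_abs (P.loss _ _ _),
    Real.norm_of_nonneg (by positivity), div_mul_eq_mul_div]
  have := H.loss_bound t ht i _ hmem
  gcongr

theorem norm_posPartGrad_le (H : P.Regular T R G σ C) (s : Fin p) {x : Vec d} (hx : ‖x‖ ≤ R) :
    ‖posPartGrad (P.con s) x‖ ≤ G := by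
  unfold posPartGrad
  split_ifs
  · exact (H.con_grad s x (by simpa using hx)).2
  · simpa using H.G_pos.le

theorem norm_penalty_le (H : P.Regular T R G σ C) (hε : 0 < ε) (hεR : ε ≤ R)
    (u : ℕ → Fin N → Vec d) {t : ℕ} (ht : 1 ≤ t) (i : Fin N) :
    ‖penalty P (trajectory P R G σ ε u t) i‖ ≤ G * (σ * (t - 1) / (2 * p * G ^ 2)
      * ∑ s, max (P.con s ((trajectory P R G σ ε u t).1 i)) 0) := by
  have ht' : (0 : ℝ) ≤ (t : ℝ) - 1 := by
    have : (1 : ℝ) ≤ t := by exact_mod_cast ht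
    linarith
  have hσ := H.σ_pos
  have hx := norm_trajectory_le (P := P) (G := G) (σ := σ) hεR u t i
  unfold penalty
  rw [mul_sum, mul_sum]
  refine (norm_sum_le _ _).trans (sum_le_sum fun s _ => ?_)
  rw [norm_smul, trajectory_dual u ht, Real.norm_of_nonneg (by positivity), mul_comm]
  have := norm_posPartGrad_le H s (hx.trans (by linarith))
  gcongr

/-- Where `c_s` is positive, convexity and `c_s(z) ≤ 0` give `⟨∇c_s(x), x - z⟩ ≥ c_s(x)`; the
multiplier is proportional to the same violation, whence squares. -/
theorem le_inner_penalty (H : P.Regular T R G σ C) (hε : 0 < ε) (hεR : ε ≤ R)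
    (u : ℕ → Fin N → Vec d) {t : ℕ} (ht : 1 ≤ t) (i : Fin N) {z : Vec d} (hz : z ∈ P.feasible) :
    σ * (t - 1) / (2 * p * G ^ 2) * ∑ s, max (P.con s ((trajectory P R G σ ε u t).1 i)) 0 ^ 2
      ≤ inner ℝ (penalty P (trajectory P R G σ ε u t) i)
          ((trajectory P R G σ ε u t).1 i - z) := by
  have ht' : (0 : ℝ) ≤ (t : ℝ) - 1 := by
    have : (1 : ℝ) ≤ t := by exact_mod_cast ht
    linarith
  have hσ := H.σ_pos
  have hx := norm_trajectory_le (P := P) (G := G) (σ := σ) hεR u t i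
  unfold penalty
  rw [sum_inner, mul_sum]
  refine sum_le_sum fun s _ => ?_
  rw [real_inner_smul_left, trajectory_dual u ht,
    sq (max (P.con s ((trajectory P R G σ ε u t).1 i)) 0), ← mul_assoc]
  have hk : 0 ≤ σ * (t - 1) / (2 * p * G ^ 2)
      * max (P.con s ((trajectory P R G σ ε u t).1 i)) 0 := by positivity
  refine mul_le_mul_of_nonneg_left ?_ hk
  unfold posPartGrad
  split_ifs with h
  · rw [max_eq_left h.le]
    have hmem : (trajectory P R G σ ε u t).1 i ∈ Ball d R := mem_closedBall_zero_iff.2 (hx.trans (by linarith))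
    have h1 := add_inner_gradient_le (H.con_convex s) (H.con_grad s _ hmem).1 z
    have h2 := hz s
    rw [← neg_sub, inner_neg_right] at h1
    linarith
  · rw [max_eq_right (not_lt.1 h), inner_zero_left]

theorem intermediate_eq (u : Fin N → Vec d) (t : ℕ) (β : ℝ) (S : State d N p) (i : Fin N) :
    intermediate P t β ε u S i
      = S.1 i - β • (onePointGrad (P.loss t i) ε (S.1 i) (u i) + penalty P S i) := rfl

/-- One descent step of a single unit. -/
theorem descent_step (H : P.Regular T R G σ C) (hε : 0 < ε) (hεR : ε ≤ R)
    {u : ℕ → Fin N → Vec d} {t : ℕ} (ht : t ∈ Icc 1 T) (i : Fin N) (hu : ‖u t i‖ = 1)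
    {z : Vec d} (hz : z ∈ P.feasible) :
    σ * t / 2 * ‖intermediate P t (1 / (σ * t)) ε (u t) (trajectory P R G σ ε u t) i - z‖ ^ 2
      ≤ σ * t / 2 * ‖(trajectory P R G σ ε u t).1 i - z‖ ^ 2
        - inner ℝ (onePointGrad (P.loss t i) ε ((trajectory P R G σ ε u t).1 i) (u t i))
            ((trajectory P R G σ ε u t).1 i - z)
        - σ / (4 * p * G ^ 2) * ((t - 1)
            * ∑ s, max (P.con s ((trajectory P R G σ ε u t).1 i)) 0 ^ 2)
        + (d * C / ε) ^ 2 / σ * (1 / t) := by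
  have ht1 : 1 ≤ t := (mem_Icc.1 ht).1
  have htR : (1 : ℝ) ≤ t := by exact_mod_cast ht1
  have hx := norm_trajectory_le (P := P) (G := G) (σ := σ) hεR u t i
  have hpen := norm_penalty_le H hε hεR u ht1 i
  have hinn := le_inner_penalty H hε hεR u ht1 i hz
  rw [intermediate_eq]
  have ho := norm_onePointGrad_le H hε ht (i := i) hx hu
  set x := (trajectory P R G σ ε u t).1 i
  set o := onePointGrad (P.loss t i) ε x (u t i)
  set g := penalty P (trajectory P R G σ ε u t) i
  have hσ := H.σ_pos
  have hG := H.G_pos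
  have hp : (0 : ℝ) < p := by exact_mod_cast H.p_pos
  have hcs : (∑ s, max (P.con s x) 0) ^ 2 ≤ p * ∑ s, max (P.con s x) 0 ^ 2 := by
    simpa using sq_sum_le_card_mul_sum_sq (s := univ) (f := fun s => max (P.con s x) 0)
  have hc0 : 0 ≤ ∑ s, max (P.con s x) 0 := sum_nonneg fun _ _ => le_max_right _ _
  set c := ∑ s, max (P.con s x) 0
  set Q := ∑ s, max (P.con s x) 0 ^ 2
  have hQ : 0 ≤ Q := sum_nonneg fun _ _ => sq_nonneg _
  have hnorm : ‖o + g‖ ^ 2 ≤ 2 * ‖o‖ ^ 2 + 2 * ‖g‖ ^ 2 := by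
    have := norm_add_le o g
    have h0 := norm_nonneg (o + g)
    nlinarith [sq_nonneg (‖o‖ - ‖g‖)]
  have ho2 : ‖o‖ ^ 2 ≤ (d * C / ε) ^ 2 := by gcongr
  have hg2 : ‖g‖ ^ 2 ≤ (G * (σ * (t - 1) / (2 * p * G ^ 2))) ^ 2 * (p * Q) := by
    calc ‖g‖ ^ 2 ≤ (G * (σ * (t - 1) / (2 * p * G ^ 2) * c)) ^ 2 := by gcongr
      _ = (G * (σ * (t - 1) / (2 * p * G ^ 2))) ^ 2 * c ^ 2 := by ring
      _ ≤ _ := by gcongr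
  -- The factor `2p` in `η_t` is made for this: after Cauchy–Schwarz over the `p` constraints, the
  -- squared penalty step uses at most half of the gain from `le_inner_penalty`, as `e4` records.
  have hg3 : 1 / (σ * t) * ((G * (σ * (t - 1) / (2 * p * G ^ 2))) ^ 2 * (p * Q))
      ≤ σ / (4 * p * G ^ 2) * ((t - 1) * Q) := by
    have e : 1 / (σ * t) * ((G * (σ * (t - 1) / (2 * p * G ^ 2))) ^ 2 * (p * Q))
        = σ / (4 * p * G ^ 2) * ((t - 1) * Q) * ((t - 1) / t) := by field_simp; ring
    rw [e]
    refine mul_le_of_le_one_right ?_ ((div_le_one (by linarith)).2 (by linarith))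
    have : (0 : ℝ) ≤ t - 1 := by linarith
    positivity
  have hexp : ‖x - (1 / (σ * t)) • (o + g) - z‖ ^ 2
      = ‖x - z‖ ^ 2 - 2 * (1 / (σ * t)) * (inner ℝ o (x - z) + inner ℝ g (x - z))
        + (1 / (σ * t)) ^ 2 * ‖o + g‖ ^ 2 := by
    rw [sub_right_comm, norm_sub_sq_real, norm_smul, real_inner_smul_right, real_inner_comm,
      inner_add_left, mul_pow, Real.norm_eq_abs, sq_abs]
    ring
  have e2 : σ * t / 2 * ‖x - (1 / (σ * t)) • (o + g) - z‖ ^ 2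
      = σ * t / 2 * ‖x - z‖ ^ 2 - inner ℝ o (x - z) - inner ℝ g (x - z)
        + 1 / (σ * t) / 2 * ‖o + g‖ ^ 2 := by
    rw [hexp]
    have : σ * t ≠ 0 := by positivity
    field_simp
    ring
  have e3 : 1 / (σ * t) / 2 * ‖o + g‖ ^ 2
      ≤ (d * C / ε) ^ 2 / σ * (1 / t) + σ / (4 * p * G ^ 2) * ((t - 1) * Q) := by
    calc 1 / (σ * t) / 2 * ‖o + g‖ ^ 2
        ≤ 1 / (σ * t) / 2 * (2 * (d * C / ε) ^ 2
            + 2 * ((G * (σ * (t - 1) / (2 * p * G ^ 2))) ^ 2 * (p * Q))) := by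
          gcongr
          linarith
      _ = (d * C / ε) ^ 2 / σ * (1 / t)
            + 1 / (σ * t) * ((G * (σ * (t - 1) / (2 * p * G ^ 2))) ^ 2 * (p * Q)) := by
          field_simp
      _ ≤ _ := by gcongr
  have e4 : σ * (t - 1) / (2 * p * G ^ 2) * Q = 2 * (σ / (4 * p * G ^ 2) * ((t - 1) * Q)) := by
    field_simp
    ring
  rw [e2]
  linarith

/-- The linearized regret of the one-point estimators plus the weighted squared constraint
violation along a trajectory. -/
theorem sum_linearized_regret_le (hw : ∀ t, 1 ≤ t → P.weight t ∈ doublyStochastic ℝ (Fin N))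
    (H : P.Regular T R G σ C) (hε : 0 < ε) (hεR : ε ≤ R)
    {u : ℕ → Fin N → Vec d} (hu : ∀ t ∈ Icc 1 T, ∀ i, ‖u t i‖ = 1)
    {z : Vec d} (hz : z ∈ P.feasible) (hzr : ‖z‖ ≤ R - ε) :
    ∑ t ∈ Icc 1 T, ∑ i, (inner ℝ
          (onePointGrad (P.loss t i) ε ((trajectory P R G σ ε u t).1 i) (u t i))
          ((trajectory P R G σ ε u t).1 i - z)
        - σ / 2 * ‖(trajectory P R G σ ε u t).1 i - z‖ ^ 2)
      + σ / (4 * p * G ^ 2) * ∑ t ∈ Icc 1 T, ∑ i, ((t - 1 : ℝ)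
            * ∑ s, max (P.con s ((trajectory P R G σ ε u t).1 i)) 0 ^ 2)
      ≤ N * (d * C / ε) ^ 2 / σ * ∑ t ∈ Icc 1 T, 1 / (t : ℝ) := by
  have hσ := H.σ_pos
  set x := fun t => (trajectory P R G σ ε u t).1 with hxdef
  set S : ℕ → ℝ := fun t => ∑ i, ‖x t i - z‖ ^ 2 with hS
  have hS0 : ∀ t, 0 ≤ S t := fun t => sum_nonneg fun _ _ => sq_nonneg _
  have hround : ∀ t ∈ Icc 1 T,
      ∑ i, (inner ℝ (onePointGrad (P.loss t i) ε (x t i) (u t i)) (x t i - z)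
          - σ / 2 * ‖x t i - z‖ ^ 2)
        + σ / (4 * p * G ^ 2) * ∑ i, ((t - 1 : ℝ) * ∑ s, max (P.con s (x t i)) 0 ^ 2)
      ≤ σ / 2 * ((t - 1) * S t - t * S (t + 1)) + N * (d * C / ε) ^ 2 / σ * (1 / (t : ℝ)) := by
    intro t ht
    have ht1 : 1 ≤ t := (mem_Icc.1 ht).1
    have h1 := sum_le_sum fun i (_ : i ∈ univ) => descent_step H hε hεR ht i (hu t ht i) hz
    have h2 := sum_sq_projBall_average_le (hw t ht1) (sub_nonneg.2 hεR)
      (intermediate P t (1 / (σ * t)) ε (u t) (trajectory P R G σ ε u t)) hzr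
    have h3 : S (t + 1) ≤ ∑ j, ‖intermediate P t (1 / (σ * t)) ε (u t)
        (trajectory P R G σ ε u t) j - z‖ ^ 2 := by
      simp only [hS, hxdef, trajectory_succ u ht1]
      exact h2
    have h4 : σ * t / 2 * S (t + 1) ≤ σ * t / 2 * ∑ j, ‖intermediate P t (1 / (σ * t)) ε (u t)
        (trajectory P R G σ ε u t) j - z‖ ^ 2 := by gcongr
    rw [sum_add_distrib, sum_sub_distrib, sum_sub_distrib, ← mul_sum, ← mul_sum, ← mul_sum] at h1
    rw [sum_sub_distrib, ← mul_sum]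
    simp only [sum_const, card_univ, Fintype.card_fin, nsmul_eq_mul] at h1
    simp only [hS, hxdef] at h4 ⊢
    have e : (N : ℝ) * ((d * C / ε) ^ 2 / σ * (1 / t)) = N * (d * C / ε) ^ 2 / σ * (1 / t) := by
      ring
    linarith
  -- The strong convexity term turned the weight `t` of `S t` into `t - 1`, so the sum telescopes
  -- without an initial term.
  have htel : ∀ T : ℕ, ∑ t ∈ Icc 1 T, (((t : ℝ) - 1) * S t - t * S (t + 1)) = - (T * S (T + 1)) := by
    intro T
    induction T with
    | zero => simp
    | succ T ih =>
      rw [sum_Icc_succ_top (by omega), ih]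
      push_cast
      ring
  have hsum := sum_le_sum hround
  rw [sum_add_distrib, sum_add_distrib, ← mul_sum, ← mul_sum, ← mul_sum, htel] at hsum
  have : 0 ≤ σ / 2 * (T * S (T + 1)) := by
    have := hS0 (T + 1)
    positivity
  linarith

/-- The cumulative disagreement of the decisions. -/
theorem sum_norm_trajectory_sub_le {B : ℕ} {ζ : ℝ} (hconn : P.JointlyConnected B)
    (hweight : P.CompatibleWeights ζ) (H : P.Regular T R G σ C) (hε : 0 < ε) (hεR : ε ≤ R)
    {u : ℕ → Fin N → Vec d} (hu : ∀ t ∈ Icc 1 T, ∀ i, ‖u t i‖ = 1) (i : Fin N) :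
    ∑ t ∈ Icc 1 T, ∑ j, ‖(trajectory P R G σ ε u t).1 i - (trajectory P R G σ ε u t).1 j‖
      ≤ cHat N B ζ * ∑ t ∈ Icc 1 T, ∑ j, (d * C / ε / σ * (1 / t)
          + (t - 1) / (2 * p * G * t)
            * ∑ s, max (P.con s ((trajectory P R G σ ε u t).1 j)) 0) := by
  have hσ := H.σ_pos
  have hG := H.G_pos
  have hp : (0 : ℝ) < p := by exact_mod_cast H.p_pos
  set x := fun t => (trajectory P R G σ ε u t).1 with hxdef
  have h1 := sum_disagreement_le hconn hweight (T := T) (X := x)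
    (e := fun t => x (t + 1) - average (P.weight t) (x t)) rfl (fun t _ _ => by abel) i
  refine h1.trans ?_
  refine mul_le_mul (le_cHat i.pos hconn.1 hweight.1 (hweight.le_one i)) (sum_le_sum fun t ht => ?_)
    (sum_nonneg fun t _ => sum_nonneg fun j _ => norm_nonneg _) ?_
  · have ht1 : 1 ≤ t := (mem_Icc.1 ht).1
    have htR : (1 : ℝ) ≤ t := by exact_mod_cast ht1
    have h2 := sum_norm_projBall_average_sub_le (hweight.2 t ht1).1 (sub_nonneg.2 hεR)
      (norm_trajectory_le (P := P) (G := G) (σ := σ) hεR u t)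
      (intermediate P t (1 / (σ * t)) ε (u t) (trajectory P R G σ ε u t))
    simp only [Pi.sub_apply, hxdef, trajectory_succ u ht1]
    refine h2.trans (sum_le_sum fun j _ => ?_)
    have ho := norm_onePointGrad_le H hε ht (i := j)
      (norm_trajectory_le (P := P) (G := G) (σ := σ) hεR u t j) (hu t ht j)
    have hpen := norm_penalty_le H hε hεR u ht1 j
    rw [intermediate_eq, sub_sub_cancel_left, norm_neg, norm_smul,
      Real.norm_of_nonneg (by positivity)]
    calc 1 / (σ * t) * ‖_‖ ≤ 1 / (σ * t) * (d * C / ε + G * (σ * (t - 1) / (2 * p * G ^ 2)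
      * ∑ s, max (P.con s ((trajectory P R G σ ε u t).1 j)) 0)) := by
          gcongr
          exact (norm_add_le _ _).trans (add_le_add ho hpen)
      _ = _ := by field_simp
  · have hB : (0 : ℝ) ≤ 2 * N * (B * (4 * N ^ 3 / ζ + 1)) := by
      have := hweight.1
      positivity
    exact hB.trans (le_cHat i.pos hconn.1 hweight.1 (hweight.le_one i))

end

end DOCO

/-! ### Measurability, independence of the past, and expected linearization -/

namespace DOCO

open Finset MeasureTheory ProbabilityTheory

section

variable {d N p : ℕ} {P : Problem d N p} {T : ℕ} {R G σ C ε : ℝ}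

/-- The state at time `t` depends only on the directions of the earlier rounds. -/
theorem trajectory_congr {u u' : ℕ → Fin N → Vec d} {t : ℕ}
    (h : ∀ s, 1 ≤ s → s < t → u s = u' s) :
    trajectory P R G σ ε u t = trajectory P R G σ ε u' t := by
  induction t with
  | zero => rfl
  | succ t ih =>
    rcases Nat.eq_zero_or_pos t with rfl | ht
    · rfl
    obtain ⟨t, rfl⟩ := Nat.exists_eq_add_of_le' ht
    have h1 := ih fun s hs hst => h s hs (by omega)
    unfold trajectory at h1 ⊢
    rw [run, run, h1, h (t + 1) (by omega) (by omega)]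

theorem measurable_gradient (f : Vec d → ℝ) : Measurable (gradient f) :=
  (InnerProductSpace.toDual ℝ (Vec d)).symm.continuous.measurable.comp (measurable_fderiv ℝ f)

theorem measurable_posPartGrad {f : Vec d → ℝ} (hf : Measurable f) : Measurable (posPartGrad f) :=
  Measurable.ite (measurableSet_lt measurable_const hf) (measurable_gradient f) measurable_const

theorem measurable_projBall (r : ℝ) : Measurable (projBall (d := d) r) :=
  Measurable.ite (measurableSet_le measurable_norm measurable_const) measurable_id
    ((measurable_const.div measurable_norm).smul measurable_id)

theorem measurable_onePointGrad {f : Vec d → ℝ} (hf : Measurable f) (ε : ℝ) :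
    Measurable fun q : Vec d × Vec d => onePointGrad f ε q.1 q.2 := by
  unfold onePointGrad
  exact (measurable_const.mul (hf.comp (measurable_fst.add (measurable_snd.const_smul ε)))).smul
    measurable_snd

theorem measurable_onePointGrad_comp {Ω : Type*} [MeasurableSpace Ω] {f : Vec d → ℝ}
    (hf : Measurable f) (ε : ℝ) {x u : Ω → Vec d} (hx : Measurable x) (hu : Measurable u) :
    Measurable fun ω => onePointGrad f ε (x ω) (u ω) :=
  (measurable_onePointGrad hf ε).comp (hx.prodMk hu)

theorem measurable_trajectory (H : P.Regular T R G σ C) {Ω : Type*} [MeasurableSpace Ω]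
    {u : Ω → ℕ → Fin N → Vec d} {t : ℕ} (htT : t ≤ T + 1)
    (hu : ∀ s, 1 ≤ s → s < t → ∀ i, Measurable fun ω => u ω s i) (i : Fin N) :
    Measurable fun ω => (trajectory P R G σ ε (u ω) t).1 i := by
  have hcon : ∀ s, Measurable (P.con s) := fun s =>
    (continuous_of_convexOn (H.con_convex s)).measurable
  induction t generalizing i with
  | zero => exact measurable_const
  | succ t ih =>
    rcases Nat.eq_zero_or_pos t with rfl | ht
    · exact measurable_const
    have hx := ih (by omega) fun s hs hst => hu s hs (by omega)
    have hloss : ∀ j, Measurable (P.loss t j) := fun j =>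
      (continuous_of_convexOn (H.loss_convex t (mem_Icc.2 ⟨ht, by omega⟩) j)).measurable
    have hy : ∀ j, Measurable fun ω =>
        intermediate P t (1 / (σ * t)) ε (u ω t) (trajectory P R G σ ε (u ω) t) j := by
      intro j
      have ho : Measurable fun ω =>
          onePointGrad (P.loss t j) ε ((trajectory P R G σ ε (u ω) t).1 j) (u ω t j) :=
        measurable_onePointGrad_comp (hloss j) ε (hx j) (hu t ht (by omega) j)
      have hpen : Measurable fun ω => penalty P (trajectory P R G σ ε (u ω) t) j := by
        unfold penalty
        refine Finset.measurable_sum _ fun s _ => ?_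
        have h1 : Measurable fun ω => (trajectory P R G σ ε (u ω) t).2 j s := by
          simp only [trajectory_dual _ ht]
          exact measurable_const.mul (((hcon s).comp (hx j)).max measurable_const)
        exact h1.smul ((measurable_posPartGrad (hcon s)).comp (hx j))
      exact (hx j).sub ((ho.add hpen).const_smul (1 / (σ * (t : ℝ))))
    simp only [trajectory_succ _ ht]
    refine (measurable_projBall _).comp ?_
    exact Finset.measurable_sum _ fun j _ => (hy j).const_smul (P.weight t i j)

/-- Integrating out an independent variable from below. -/
theorem integral_le_of_indepFun {Ω α β : Type*} [MeasurableSpace Ω] [MeasurableSpace α]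
    [MeasurableSpace β] {μ : Measure Ω} [IsProbabilityMeasure μ] {X : Ω → α} {U : Ω → β}
    (hX : Measurable X) (hU : Measurable U) (h : IndepFun X U μ) {F : α × β → ℝ}
    (hF : Measurable F) (hFi : Integrable (fun ω => F (X ω, U ω)) μ) {Φ : α → ℝ}
    (hΦi : Integrable (fun ω => Φ (X ω)) μ)
    (hle : ∀ ω, Φ (X ω) ≤ ∫ b, F (X ω, b) ∂μ.map U) :
    ∫ ω, Φ (X ω) ∂μ ≤ ∫ ω, F (X ω, U ω) ∂μ := by
  have hprod := (indepFun_iff_map_prod_eq_prod_map_map hX.aemeasurable hU.aemeasurable).1 h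
  have hp : IsProbabilityMeasure (μ.map X) := Measure.isProbabilityMeasure_map hX.aemeasurable
  have hp' : IsProbabilityMeasure (μ.map U) := Measure.isProbabilityMeasure_map hU.aemeasurable
  have hFi' : Integrable F ((μ.map X).prod (μ.map U)) := by
    rw [← hprod]
    exact (integrable_map_measure hF.aestronglyMeasurable (hX.prodMk hU).aemeasurable).2 hFi
  have hinner : Integrable (fun ω => ∫ b, F (X ω, b) ∂μ.map U) μ :=
    (integrable_map_measure hFi'.integral_prod_left.aestronglyMeasurable hX.aemeasurable).1
      hFi'.integral_prod_left
  have e : ∫ ω, F (X ω, U ω) ∂μ = ∫ ω, ∫ b, F (X ω, b) ∂μ.map U ∂μ := by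
    rw [← integral_map (hX.prodMk hU).aemeasurable hF.aestronglyMeasurable, hprod,
      integral_prod _ hFi',
      integral_map hX.aemeasurable hFi'.integral_prod_left.aestronglyMeasurable]
  rw [e]
  exact integral_mono hΦi hinner hle

/-- The decision is a measurable function of the directions of all units in earlier rounds, a finite
family disjoint from the single index `(t, i)`. -/
theorem indepFun_trajectory (H : P.Regular T R G σ C) {Ω : Type*} [MeasurableSpace Ω]
    {μ : Measure Ω} {u : Ω → ℕ → Fin N → Vec d} (hu : IsExploration μ T u) {t : ℕ}
    (ht : t ∈ Icc 1 T) (i : Fin N) :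
    IndepFun (fun ω => (trajectory P R G σ ε (u ω) t).1 i) (fun ω => u ω t i) μ := by
  classical
  let q : Icc 1 T × Fin N := (⟨t, ht⟩, i)
  let S : Finset (Icc 1 T × Fin N) := univ.filter fun q => (q.1 : ℕ) < t
  have hdisj : Disjoint S {q} := by
    rw [disjoint_singleton_right]
    simp [S, q]
  have h := hu.indep.indepFun_finset S {q} hdisj fun q => hu.measurable q.1 q.1.2 q.2
  -- Past directions extended by zero. By `trajectory_congr` the filler does not affect the state at
  -- time `t`, which thereby becomes a function of the past tuple.
  let ext : (S → Vec d) → ℕ → Fin N → Vec d := fun w s j =>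
    if hs : s ∈ Icc 1 T then
      if hS : (⟨s, hs⟩, j) ∈ S then w ⟨(⟨s, hs⟩, j), hS⟩ else 0
    else 0
  have hext : ∀ s j, Measurable fun w => ext w s j := by
    intro s j
    simp only [ext]
    split_ifs
    · exact measurable_pi_apply _
    · exact measurable_const
    · exact measurable_const
  have hm := measurable_trajectory (ε := ε) H (u := ext) (t := t)
    (by have := (mem_Icc.1 ht).2; omega) (fun s _ _ j => hext s j) i
  have h2 := h.comp hm (measurable_pi_apply (⟨q, mem_singleton_self q⟩ : ({q} : Finset _)))
  have e : (fun ω => (trajectory P R G σ ε (u ω) t).1 i)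
      = (fun w => (trajectory P R G σ ε (ext w) t).1 i) ∘ fun ω (q : S) => u ω q.1.1 q.1.2 := by
    ext1 ω
    simp only [Function.comp]
    rw [trajectory_congr (u' := ext fun q : S => u ω q.1.1 q.1.2)]
    intro s hs hst
    ext1 j
    have hs' : s ∈ Icc 1 T := mem_Icc.2 ⟨hs, by have := (mem_Icc.1 ht).2; omega⟩
    simp only [ext, dif_pos hs', S, mem_filter, mem_univ, hst, and_self, dif_pos]
  rw [e]
  exact h2

/-- One-sided, from the first-order inequality at `a` alone, so `b` may be any point. -/
theorem loss_sub_le (H : P.Regular T R G σ C) {t : ℕ} (ht : t ∈ Icc 1 T) (i : Fin N)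
    {a b : Vec d} (ha : ‖a‖ ≤ R) : P.loss t i a - P.loss t i b ≤ G * ‖a - b‖ := by
  obtain ⟨hd, hg⟩ := H.loss_grad t ht i a (by simpa using ha)
  have h1 := add_inner_gradient_le (H.loss_convex t ht i) hd b
  have h2 := real_inner_le_norm (gradient (P.loss t i) a) (a - b)
  rw [← neg_sub, inner_neg_right] at h1
  have h3 : ‖gradient (P.loss t i) a‖ * ‖a - b‖ ≤ G * ‖a - b‖ := by gcongr
  linarith

/-- The one-point estimator linearizes the loss up to the exploration error. -/
theorem le_integral_inner_onePointGrad (hd : 1 ≤ d) (H : P.Regular T R G σ C) (hε : 0 < ε)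
    {t : ℕ} (ht : t ∈ Icc 1 T) (i : Fin N) {x z : Vec d} (hx : ‖x‖ ≤ R - ε) (hz : ‖z‖ ≤ R - ε) :
    max (P.loss t i x - P.loss t i z - 2 * G * ε) (-(2 * G * R)) + σ / 2 * ‖x - z‖ ^ 2
      ≤ ∫ u, inner ℝ (onePointGrad (P.loss t i) ε x u) (x - z) ∂uniformSphere d := by
  have hG := H.G_pos
  refine le_integral_onePointGrad hd (H.loss_grad t ht i) hG.le hε hx _ fun v hv => ?_
  have hs : ‖ε • v‖ ≤ ε := by
    rw [norm_smul, Real.norm_of_nonneg hε.le]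
    exact mul_le_of_le_one_right hε.le hv
  have hmem : ∀ y : Vec d, ‖y‖ ≤ R - ε → ‖y + ε • v‖ ≤ R := fun y hy =>
    (norm_add_le _ _).trans (by linarith)
  -- Shifting both points by the same `ε • v` leaves their difference equal to `x - z`, so the
  -- quadratic term survives unchanged.
  have h1 := H.loss_strong t ht i (z + ε • v) (by simpa using hmem z hz) (x + ε • v)
    (by simpa using hmem x hx)
  rw [add_sub_add_right_eq_sub, ← neg_sub, inner_neg_right, norm_neg] at h1
  have h2 : P.loss t i x - P.loss t i (x + ε • v) ≤ G * ε := by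
    refine (loss_sub_le H ht i (by linarith)).trans ?_
    rw [sub_add_cancel_left, norm_neg]
    gcongr
  have h3 : P.loss t i (z + ε • v) - P.loss t i z ≤ G * ε := by
    refine (loss_sub_le H ht i (hmem z hz)).trans ?_
    rw [add_sub_cancel_left]
    gcongr
  -- Second branch of the maximum: a floor free of the exploration error, needed for the exact
  -- constant in the violation bound.
  have h4 : P.loss t i (z + ε • v) - P.loss t i (x + ε • v) ≤ G * (2 * R) := by
    refine (loss_sub_le H ht i (hmem z hz)).trans ?_
    have := norm_sub_le (z + ε • v) (x + ε • v)
    gcongr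
    linarith [hmem z hz, hmem x hx]
  rw [← max_add_add_right]
  exact max_le (by linarith) (by linarith)

variable {Ω : Type*} [MeasurableSpace Ω] {μ : Measure Ω}
  {u : Ω → ℕ → Fin N → Vec d}

theorem ae_norm_eq_one (hu : IsExploration μ T u) :
    ∀ᵐ ω ∂μ, ∀ t ∈ Icc 1 T, ∀ i, ‖u ω t i‖ = 1 := by
  rw [ae_all_iff]
  intro t
  by_cases ht : t ∈ Icc 1 T
  swap
  · exact .of_forall fun ω h => absurd h ht
  suffices ∀ᵐ ω ∂μ, ∀ i, ‖u ω t i‖ = 1 from this.mono fun ω h _ => h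
  rw [ae_all_iff]
  intro i
  refine ae_of_ae_map (hu.measurable t ht i).aemeasurable (p := fun v => ‖v‖ = 1) ?_
  rw [hu.law t ht i]
  exact ae_norm_eq_one_uniformSphere

theorem measurable_trajectory_of_isExploration (H : P.Regular T R G σ C)
    (hu : IsExploration μ T u) {t : ℕ} (ht : t ∈ Icc 1 T) (i : Fin N) :
    Measurable fun ω => (trajectory P R G σ ε (u ω) t).1 i :=
  measurable_trajectory H (by have := (mem_Icc.1 ht).2; omega)
    (fun s hs hst => hu.measurable s (mem_Icc.2 ⟨hs, by have := (mem_Icc.1 ht).2; omega⟩)) i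

theorem integrable_comp_trajectory [IsProbabilityMeasure μ] (H : P.Regular T R G σ C) (hεR : ε ≤ R)
    (hu : IsExploration μ T u) {t : ℕ} (ht : t ∈ Icc 1 T) (i : Fin N) {f : Vec d → ℝ}
    (hf : Continuous f) : Integrable (fun ω => f ((trajectory P R G σ ε (u ω) t).1 i)) μ := by
  obtain ⟨M, hM⟩ := (isCompact_closedBall (0 : Vec d) (R - ε)).exists_bound_of_continuousOn
    hf.continuousOn
  refine Integrable.of_bound (C := M) (hf.measurable.comp
    (measurable_trajectory_of_isExploration H hu ht i)).aestronglyMeasurable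
    (.of_forall fun ω => hM _ ?_)
  simpa using norm_trajectory_le hεR (u ω) t i

theorem integrable_inner_onePointGrad [IsProbabilityMeasure μ] (H : P.Regular T R G σ C) (hε : 0 < ε) (hεR : ε ≤ R)
    (hu : IsExploration μ T u) {t : ℕ} (ht : t ∈ Icc 1 T) (i : Fin N) (z : Vec d) :
    Integrable (fun ω => inner ℝ
      (onePointGrad (P.loss t i) ε ((trajectory P R G σ ε (u ω) t).1 i) (u ω t i))
      ((trajectory P R G σ ε (u ω) t).1 i - z)) μ := by
  have hx := measurable_trajectory_of_isExploration (ε := ε) H hu ht i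
  have hloss := (continuous_of_convexOn (H.loss_convex t ht i)).measurable
  refine Integrable.of_bound (C := d * C / ε * (R - ε + ‖z‖)) (Measurable.aestronglyMeasurable
    (((measurable_onePointGrad hloss ε).comp (hx.prodMk (hu.measurable t ht i))).inner
      (hx.sub measurable_const))) ?_
  filter_upwards [ae_norm_eq_one hu] with ω hω
  have h1 := norm_trajectory_le (P := P) (G := G) (σ := σ) hεR (u ω) t i
  have h2 := norm_onePointGrad_le H hε ht (i := i) h1 (hω t ht i)
  refine (norm_inner_le_norm _ _).trans ?_
  refine mul_le_mul h2 ((norm_sub_le _ _).trans (by linarith)) (norm_nonneg _)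
    ((norm_nonneg _).trans h2)

theorem integrable_linearized_regret [IsProbabilityMeasure μ] (H : P.Regular T R G σ C) (hε : 0 < ε) (hεR : ε ≤ R)
    (hu : IsExploration μ T u) {t : ℕ} (ht : t ∈ Icc 1 T) (i : Fin N) (z : Vec d) :
    Integrable (fun ω => inner ℝ
      (onePointGrad (P.loss t i) ε ((trajectory P R G σ ε (u ω) t).1 i) (u ω t i))
      ((trajectory P R G σ ε (u ω) t).1 i - z)
      - σ / 2 * ‖(trajectory P R G σ ε (u ω) t).1 i - z‖ ^ 2) μ :=
  (integrable_inner_onePointGrad H hε hεR hu ht i z).sub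
    (integrable_comp_trajectory H hεR hu ht i (f := fun x => σ / 2 * ‖x - z‖ ^ 2) (by fun_prop))

/-- The expected linearized regret dominates the expected regret up to the exploration error. -/
theorem integral_loss_le_linearized_regret [IsProbabilityMeasure μ] (hd : 1 ≤ d)
    (H : P.Regular T R G σ C) (hε : 0 < ε) (hεR : ε ≤ R) (hu : IsExploration μ T u) {t : ℕ} (ht : t ∈ Icc 1 T) (i : Fin N) {z : Vec d}
    (hz : ‖z‖ ≤ R - ε) :
    ∫ ω, max (P.loss t i ((trajectory P R G σ ε (u ω) t).1 i) - P.loss t i z - 2 * G * ε)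
        (-(2 * G * R)) ∂μ
      ≤ ∫ ω, (inner ℝ
      (onePointGrad (P.loss t i) ε ((trajectory P R G σ ε (u ω) t).1 i) (u ω t i))
      ((trajectory P R G σ ε (u ω) t).1 i - z)
      - σ / 2 * ‖(trajectory P R G σ ε (u ω) t).1 i - z‖ ^ 2) ∂μ := by
  have hloss := continuous_of_convexOn (H.loss_convex t ht i)
  have hi1 := integrable_comp_trajectory H hεR hu ht i
    (f := fun x => max (P.loss t i x - P.loss t i z - 2 * G * ε) (-(2 * G * R))) (by fun_prop)
  have hi2 := integrable_comp_trajectory H hεR hu ht i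
    (f := fun x => σ / 2 * ‖x - z‖ ^ 2) (by fun_prop)
  have hi3 := integrable_inner_onePointGrad H hε hεR hu ht i z
  have h := integral_le_of_indepFun (measurable_trajectory_of_isExploration H hu ht i)
    (hu.measurable t ht i) (indepFun_trajectory H hu ht i)
    (F := fun q => inner ℝ (onePointGrad (P.loss t i) ε q.1 q.2) (q.1 - z))
    ((measurable_onePointGrad hloss.measurable ε).inner (measurable_fst.sub measurable_const)) hi3
    (Φ := fun x => max (P.loss t i x - P.loss t i z - 2 * G * ε) (-(2 * G * R))
      + σ / 2 * ‖x - z‖ ^ 2) (hi1.add hi2) fun ω => by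
      rw [hu.law t ht i]
      exact le_integral_inner_onePointGrad hd H hε ht i
        (norm_trajectory_le hεR (u ω) t i) hz
  rw [integral_sub hi3 hi2]
  simp only at h
  rw [integral_add hi1 hi2] at h
  linarith

end

end DOCO

/-! ### Expected regret and expected violation for general exploration radius -/

namespace DOCO

open Finset MeasureTheory ProbabilityTheory

section

variable {d N p : ℕ} {P : Problem d N p} {T : ℕ} {R G σ C ε : ℝ}

theorem cHat_nonneg {B : ℕ} {ζ : ℝ} (hconn : P.JointlyConnected B)
    (hweight : P.CompatibleWeights ζ) (i : Fin N) : 0 ≤ cHat N B ζ := by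
  have hB : (0 : ℝ) ≤ 2 * N * (B * (4 * N ^ 3 / ζ + 1)) := by
    have := hweight.1
    positivity
  exact hB.trans (le_cHat i.pos hconn.1 hweight.1 (hweight.le_one i))

/-- The squared violations absorb the part of the disagreement caused by the penalties. -/
theorem disagreement_young {K t c q : ℝ} (hσ : 0 < σ) (hG : 0 < G) (hq : 0 < q) (ht : 1 ≤ t) :
    G * (K * ((t - 1) / (2 * q * G * t) * c))
      ≤ σ / (4 * q * G ^ 2) * ((t - 1) * c ^ 2) + K ^ 2 * G ^ 2 / (4 * q * σ) * (1 / t) := by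
  have ht0 : 0 < t := by linarith
  have h1 : 0 ≤ σ / (4 * q * G ^ 2) * ((t - 1) * (c - K * G ^ 2 / (σ * t)) ^ 2) := by
    have : 0 ≤ t - 1 := by linarith
    positivity
  have h2 : σ / (4 * q * G ^ 2) * ((t - 1) * (c - K * G ^ 2 / (σ * t)) ^ 2)
      = σ / (4 * q * G ^ 2) * ((t - 1) * c ^ 2) - G * (K * ((t - 1) / (2 * q * G * t) * c))
        + K ^ 2 * G ^ 2 / (4 * q * σ) * (1 / t) * ((t - 1) / t) := by
    field_simp
    ring
  have h3 : K ^ 2 * G ^ 2 / (4 * q * σ) * (1 / t) * ((t - 1) / t)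
      ≤ K ^ 2 * G ^ 2 / (4 * q * σ) * (1 / t) :=
    mul_le_of_le_one_right (by positivity) ((div_le_one ht0).2 (by linarith))
  linarith

/-- The squared violations available from the descent estimate are spent entirely on the part of the
disagreement caused by penalties; only harmonic terms remain. -/
theorem linearized_regret_add_disagreement_le {B : ℕ} {ζ : ℝ} (hconn : P.JointlyConnected B)
    (hweight : P.CompatibleWeights ζ) (H : P.Regular T R G σ C) (hε : 0 < ε) (hεR : ε ≤ R)
    {u : ℕ → Fin N → Vec d} (hu : ∀ t ∈ Icc 1 T, ∀ i, ‖u t i‖ = 1) (i : Fin N)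
    {z : Vec d} (hz : z ∈ P.feasible) (hzr : ‖z‖ ≤ R - ε) :
    ∑ t ∈ Icc 1 T, ∑ j, (inner ℝ
          (onePointGrad (P.loss t j) ε ((trajectory P R G σ ε u t).1 j) (u t j))
          ((trajectory P R G σ ε u t).1 j - z)
        - σ / 2 * ‖(trajectory P R G σ ε u t).1 j - z‖ ^ 2)
      + G * ∑ t ∈ Icc 1 T, ∑ j,
          ‖(trajectory P R G σ ε u t).1 i - (trajectory P R G σ ε u t).1 j‖
      ≤ (N * (d * C / ε) ^ 2 / σ + G * cHat N B ζ * N * (d * C / ε) / σ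
          + N * cHat N B ζ ^ 2 * G ^ 2 / (4 * σ)) * ∑ t ∈ Icc 1 T, 1 / (t : ℝ) := by
  have hσ := H.σ_pos
  have hG := H.G_pos
  have hp : (0 : ℝ) < p := by exact_mod_cast H.p_pos
  have hA := sum_linearized_regret_le (fun t ht => (hweight.2 t ht).1) H hε hεR hu hz hzr
  have hB := mul_le_mul_of_nonneg_left
    (sum_norm_trajectory_sub_le hconn hweight H hε hεR hu i) hG.le
  set K := cHat N B ζ
  set x := fun t => (trajectory P R G σ ε u t).1
  have hY : G * (K * ∑ t ∈ Icc 1 T, ∑ j, (d * C / ε / σ * (1 / t)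
          + (t - 1) / (2 * p * G * t) * ∑ s, max (P.con s (x t j)) 0))
      ≤ G * K * N * (d * C / ε) / σ * ∑ t ∈ Icc 1 T, 1 / (t : ℝ)
        + (σ / (4 * p * G ^ 2) * ∑ t ∈ Icc 1 T, ∑ j, ((t - 1 : ℝ)
            * ∑ s, max (P.con s (x t j)) 0 ^ 2)
        + N * K ^ 2 * G ^ 2 / (4 * σ) * ∑ t ∈ Icc 1 T, 1 / (t : ℝ)) := by
    simp only [mul_sum (s := Icc 1 T)]
    rw [← sum_add_distrib, ← sum_add_distrib]
    refine sum_le_sum fun t ht => ?_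
    have htR : (1 : ℝ) ≤ t := by exact_mod_cast (mem_Icc.1 ht).1
    have hj : ∀ j, G * (K * ((t - 1) / (2 * p * G * t) * ∑ s, max (P.con s (x t j)) 0))
        ≤ σ / (4 * p * G ^ 2) * ((t - 1) * ∑ s, max (P.con s (x t j)) 0 ^ 2)
          + K ^ 2 * G ^ 2 / (4 * σ) * (1 / t) := by
      intro j
      have := sum_le_sum fun s (_ : s ∈ (univ : Finset (Fin p))) =>
        disagreement_young (K := K) (c := max (P.con s (x t j)) 0) hσ hG hp htR
      rw [sum_add_distrib] at this
      simp only [← mul_sum, sum_const, card_univ, Fintype.card_fin, nsmul_eq_mul] at this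
      have e : (p : ℝ) * (K ^ 2 * G ^ 2 / (4 * p * σ) * (1 / t))
          = K ^ 2 * G ^ 2 / (4 * σ) * (1 / t) := by field_simp
      linarith
    have hs := sum_le_sum fun j (_ : j ∈ (univ : Finset (Fin N))) => hj j
    rw [sum_add_distrib] at hs
    simp only [← mul_sum, sum_const, card_univ, Fintype.card_fin, nsmul_eq_mul] at hs
    simp only [sum_add_distrib, ← mul_sum, sum_const, card_univ, Fintype.card_fin, nsmul_eq_mul]
    have e : G * (K * (d * C / ε / σ * (N * (1 / t)) + (t - 1) / (2 * p * G * t)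
        * ∑ j, ∑ s, max (P.con s (x t j)) 0))
        = G * K * N * (d * C / ε) / σ * (1 / t)
          + G * (K * ((t - 1) / (2 * p * G * t) * ∑ j, ∑ s, max (P.con s (x t j)) 0)) := by ring
    rw [e]
    have e2 : K ^ 2 * G ^ 2 / (4 * σ) * (N * (1 / t))
        = N * K ^ 2 * G ^ 2 / (4 * σ) * (1 / t) := by ring
    linarith
  rw [add_mul, add_mul]
  linarith

/-- Arithmetic-geometric inequality with weight `θ(t-1)`. The parameter `θ` stays free so that it
can be optimized after taking expectations. -/
theorem sum_violation_le (H : P.Regular T R G σ C) (u : ℕ → Fin N → Vec d) {θ : ℝ} (hθ : 0 < θ) :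
    ∑ t ∈ Icc 1 T, ∑ i, ∑ s, max (P.con s ((trajectory P R G σ ε u t).1 i)) 0
      ≤ θ / 2 * ∑ t ∈ Icc 1 T, ∑ i, ((t - 1 : ℝ)
            * ∑ s, max (P.con s ((trajectory P R G σ ε u t).1 i)) 0 ^ 2)
        + N * p / (2 * θ) * ∑ t ∈ Icc 1 T, 1 / (t : ℝ) := by
  have hpt : ∀ t ∈ Icc 1 T, ∑ i, ∑ s, max (P.con s ((trajectory P R G σ ε u t).1 i)) 0
      ≤ θ / 2 * ∑ i, ((t - 1 : ℝ)
            * ∑ s, max (P.con s ((trajectory P R G σ ε u t).1 i)) 0 ^ 2)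
        + N * p / (2 * θ) * (1 / ((t : ℝ) - 1)) := by
    intro t ht
    have h : ∀ i s, max (P.con s ((trajectory P R G σ ε u t).1 i)) 0
        ≤ θ / 2 * ((t - 1) * max (P.con s ((trajectory P R G σ ε u t).1 i)) 0 ^ 2)
          + 1 / (2 * θ) * (1 / ((t : ℝ) - 1)) := by
      intro i s
      rcases (mem_Icc.1 ht).1.eq_or_lt with rfl | h1
      -- At `t = 1` the weight is zero, but the start `0` is feasible and there is no violation. The
      -- term `1/(t-1)` is then `1/0 = 0`.
      · simp [trajectory_one, H.con_zero s]
      · have ht1 : (0 : ℝ) < (t : ℝ) - 1 := by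
          have : (1 : ℝ) < t := by exact_mod_cast h1
          linarith
        set c := max (P.con s ((trajectory P R G σ ε u t).1 i)) 0
        have h2 : 0 ≤ (θ * (t - 1) * c - 1) ^ 2 / (2 * θ * (t - 1)) := by positivity
        have h3 : (θ * (t - 1) * c - 1) ^ 2 / (2 * θ * (t - 1))
            = θ / 2 * ((t - 1) * c ^ 2) + 1 / (2 * θ) * (1 / ((t : ℝ) - 1)) - c := by
          field_simp
          ring
        linarith
    refine (sum_le_sum fun i _ => sum_le_sum fun s _ => h i s).trans (le_of_eq ?_)
    simp only [sum_add_distrib, ← mul_sum, sum_const, card_univ, Fintype.card_fin, nsmul_eq_mul]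
    ring
  refine (sum_le_sum hpt).trans ?_
  rw [sum_add_distrib, ← mul_sum, ← mul_sum]
  refine add_le_add le_rfl (mul_le_mul_of_nonneg_left ?_ (by positivity))
  -- With the first term zero by convention, the left side is the harmonic sum up to `n - 1`.
  have hshift : ∀ n : ℕ, ∑ t ∈ Icc 1 n, 1 / ((t : ℝ) - 1) ≤ ∑ t ∈ Icc 1 n, 1 / (t : ℝ)
      - if n = 0 then 0 else 1 / (n : ℝ) := by
    intro n
    induction n with
    | zero => simp
    | succ n ih =>
      rw [sum_Icc_succ_top (by omega), sum_Icc_succ_top (by omega)]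
      rcases Nat.eq_zero_or_pos n with rfl | hn
      · simp
      · simp only [hn.ne', if_false] at ih
        simp only [Nat.succ_ne_zero, if_false]
        push_cast
        rw [add_sub_cancel_right]
        linarith
  refine (hshift T).trans (sub_le_self _ ?_)
  split_ifs <;> positivity

variable {Ω : Type*} [MeasurableSpace Ω] {μ : Measure Ω} [IsProbabilityMeasure μ]
  {u : Ω → ℕ → Fin N → Vec d}

theorem integrable_regret (H : P.Regular T R G σ C) (hεR : ε ≤ R) (hu : IsExploration μ T u)
    (xstar : Vec d) (i : Fin N) : Integrable
      (fun ω => regret P T xstar (fun t i => (trajectory P R G σ ε (u ω) t).1 i) i) μ := by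
  unfold regret
  refine Integrable.sub (integrable_finsetSum _ fun t ht => integrable_finsetSum _ fun j _ => ?_)
    (integrable_const _)
  exact integrable_comp_trajectory H hεR hu ht i (continuous_of_convexOn (H.loss_convex t ht j))

/-- The bias `3Gε` per unit and round is `2Gε` from exploration and `Gε` from replacing `x*` by `z`;
passing from `x_j` to `x_i` costs the disagreement. -/
theorem integral_regret_le {B : ℕ} {ζ : ℝ} (hd : 1 ≤ d) (hconn : P.JointlyConnected B)
    (hweight : P.CompatibleWeights ζ) (H : P.Regular T R G σ C) (hε : 0 < ε) (hεR : ε ≤ R)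
    (hu : IsExploration μ T u) (i : Fin N) {z xstar : Vec d} (hz : z ∈ P.feasible)
    (hzr : ‖z‖ ≤ R - ε) (hzx : ‖z - xstar‖ ≤ ε) :
    ∫ ω, regret P T xstar (fun t i => (trajectory P R G σ ε (u ω) t).1 i) i ∂μ
      ≤ (N * (d * C / ε) ^ 2 / σ + G * cHat N B ζ * N * (d * C / ε) / σ
          + N * cHat N B ζ ^ 2 * G ^ 2 / (4 * σ)) * ∑ t ∈ Icc 1 T, 1 / (t : ℝ)
        + 3 * N * G * ε * T := by
  have hG := H.G_pos
  set K₁ := (N * (d * C / ε) ^ 2 / σ + G * cHat N B ζ * N * (d * C / ε) / σ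
          + N * cHat N B ζ ^ 2 * G ^ 2 / (4 * σ)) * ∑ t ∈ Icc 1 T, 1 / (t : ℝ)
  let W : ℕ → Fin N → Ω → ℝ := fun t j ω => inner ℝ
    (onePointGrad (P.loss t j) ε ((trajectory P R G σ ε (u ω) t).1 j) (u ω t j))
      ((trajectory P R G σ ε (u ω) t).1 j - z)
      - σ / 2 * ‖(trajectory P R G σ ε (u ω) t).1 j - z‖ ^ 2
  let V : ℕ → Fin N → Ω → ℝ := fun t j ω =>
    max (P.loss t j ((trajectory P R G σ ε (u ω) t).1 j) - P.loss t j z - 2 * G * ε)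
      (-(2 * G * R))
  have hWi : ∀ t ∈ Icc 1 T, ∀ j, Integrable (W t j) μ := fun t ht j =>
    integrable_linearized_regret H hε hεR hu ht j z
  have hVi : ∀ t ∈ Icc 1 T, ∀ j, Integrable (V t j) μ := fun t ht j => by
    have := continuous_of_convexOn (H.loss_convex t ht j)
    exact integrable_comp_trajectory H hεR hu ht j
      (f := fun x => max (P.loss t j x - P.loss t j z - 2 * G * ε) (-(2 * G * R))) (by fun_prop)
  have hVW : ∑ t ∈ Icc 1 T, ∑ j, ∫ ω, V t j ω ∂μ ≤ ∑ t ∈ Icc 1 T, ∑ j, ∫ ω, W t j ω ∂μ :=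
    sum_le_sum fun t ht => sum_le_sum fun j _ =>
      integral_loss_le_linearized_regret hd H hε hεR hu ht j hzr
  -- Adding `W - V` eliminates the disagreement pathwise, and the correction has nonnegative
  -- expectation by `hVW`.
  have hpath : ∀ᵐ ω ∂μ, regret P T xstar (fun t i => (trajectory P R G σ ε (u ω) t).1 i) i
      + (∑ t ∈ Icc 1 T, ∑ j, W t j ω - ∑ t ∈ Icc 1 T, ∑ j, V t j ω)
      ≤ K₁ + 3 * N * G * ε * T := by
    filter_upwards [ae_norm_eq_one hu] with ω hω
    have h1 := linearized_regret_add_disagreement_le hconn hweight H hε hεR hω i hz hzr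
    have h2 : regret P T xstar (fun t i => (trajectory P R G σ ε (u ω) t).1 i) i
        ≤ ∑ t ∈ Icc 1 T, ∑ j, (V t j ω
          + G * ‖(trajectory P R G σ ε (u ω) t).1 i - (trajectory P R G σ ε (u ω) t).1 j‖
          + 3 * G * ε) := by
      unfold regret
      rw [← sum_sub_distrib]
      refine sum_le_sum fun t ht => ?_
      rw [← sum_sub_distrib]
      refine sum_le_sum fun j _ => ?_
      have hx := fun k => norm_trajectory_le (P := P) (G := G) (σ := σ) hεR (u ω) t k
      have e1 := loss_sub_le H ht j (b := (trajectory P R G σ ε (u ω) t).1 j)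
        ((hx i).trans (by linarith))
      have e2 : P.loss t j z - P.loss t j xstar ≤ G * ε :=
        (loss_sub_le H ht j (hzr.trans (by linarith))).trans (by gcongr)
      have e3 : P.loss t j ((trajectory P R G σ ε (u ω) t).1 j) - P.loss t j z - 2 * G * ε
        ≤ V t j ω := le_max_left _ _
      linarith
    simp only [sum_add_distrib, ← mul_sum, sum_const, card_univ, Fintype.card_fin, nsmul_eq_mul,
      Nat.card_Icc, Nat.add_sub_cancel] at h2
    have h3 : ∑ t ∈ Icc 1 T, ∑ j, W t j ω + G * ∑ t ∈ Icc 1 T, ∑ j,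
          ‖(trajectory P R G σ ε (u ω) t).1 i - (trajectory P R G σ ε (u ω) t).1 j‖ ≤ K₁ := h1
    linarith
  have hWs : Integrable (fun ω => ∑ t ∈ Icc 1 T, ∑ j, W t j ω) μ :=
    integrable_finsetSum _ fun t ht => integrable_finsetSum _ fun j _ => hWi t ht j
  have hVs : Integrable (fun ω => ∑ t ∈ Icc 1 T, ∑ j, V t j ω) μ :=
    integrable_finsetSum _ fun t ht => integrable_finsetSum _ fun j _ => hVi t ht j
  have hreg := integrable_regret H hεR hu xstar i
  have h_int := integral_mono_ae (hreg.add (hWs.sub hVs)) (integrable_const _) hpath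
  have e1 : ∫ ω, (∑ t ∈ Icc 1 T, ∑ j, W t j ω) ∂μ = ∑ t ∈ Icc 1 T, ∑ j, ∫ ω, W t j ω ∂μ := by
    rw [integral_finsetSum _ fun t ht => integrable_finsetSum _ fun j _ => hWi t ht j]
    exact sum_congr rfl fun t ht => integral_finsetSum _ fun j _ => hWi t ht j
  have e2 : ∫ ω, (∑ t ∈ Icc 1 T, ∑ j, V t j ω) ∂μ = ∑ t ∈ Icc 1 T, ∑ j, ∫ ω, V t j ω ∂μ := by
    rw [integral_finsetSum _ fun t ht => integrable_finsetSum _ fun j _ => hVi t ht j]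
    exact sum_congr rfl fun t ht => integral_finsetSum _ fun j _ => hVi t ht j
  simp only [Pi.add_apply, Pi.sub_apply] at h_int
  have e3 := integral_sub hWs hVs
  have e4 := integral_add hreg (hWs.sub hVs)
  simp only [Pi.sub_apply] at e4
  rw [e4, e3, e1, e2, integral_const, probReal_univ, one_smul] at h_int
  linarith

theorem integrable_violation (H : P.Regular T R G σ C) (hεR : ε ≤ R) (hu : IsExploration μ T u)
    {t : ℕ} (ht : t ∈ Icc 1 T) (i : Fin N) (s : Fin p) :
    Integrable (fun ω => max (P.con s ((trajectory P R G σ ε (u ω) t).1 i)) 0) μ := by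
  have := continuous_of_convexOn (H.con_convex s)
  exact integrable_comp_trajectory H hεR hu ht i (f := fun x => max (P.con s x) 0) (by fun_prop)

/-- A very negative linearized regret is the only way to allow large squared violations, and the
floor `-2GR` excludes it in expectation. Connectivity plays no role. -/
theorem sum_integral_violation_le (hd : 1 ≤ d)
    (hw : ∀ t, 1 ≤ t → P.weight t ∈ doublyStochastic ℝ (Fin N))
    (H : P.Regular T R G σ C) (hε : 0 < ε) (hεR : ε ≤ R)
    (hu : IsExploration μ T u) {z : Vec d} (hz : z ∈ P.feasible) (hzr : ‖z‖ ≤ R - ε)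
    {θ : ℝ} (hθ : 0 < θ) :
    ∑ t ∈ Icc 1 T, ∑ i, ∑ s, ∫ ω, max (P.con s ((trajectory P R G σ ε (u ω) t).1 i)) 0 ∂μ
      ≤ θ * (2 * p * G ^ 2 / σ) * (N * (d * C / ε) ^ 2 / σ * ∑ t ∈ Icc 1 T, 1 / (t : ℝ)
          + 2 * G * R * N * T) + N * p / (2 * θ) * ∑ t ∈ Icc 1 T, 1 / (t : ℝ) := by
  have hσ := H.σ_pos
  have hG := H.G_pos
  have hp : (0 : ℝ) < p := by exact_mod_cast H.p_pos
  let W : ℕ → Fin N → Ω → ℝ := fun t j ω => inner ℝ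
    (onePointGrad (P.loss t j) ε ((trajectory P R G σ ε (u ω) t).1 j) (u ω t j))
      ((trajectory P R G σ ε (u ω) t).1 j - z)
      - σ / 2 * ‖(trajectory P R G σ ε (u ω) t).1 j - z‖ ^ 2
  have hWi : ∀ t ∈ Icc 1 T, ∀ j, Integrable (W t j) μ := fun t ht j =>
    integrable_linearized_regret H hε hεR hu ht j z
  have hWlow : ∀ t ∈ Icc 1 T, ∀ j, -(2 * G * R) ≤ ∫ ω, W t j ω ∂μ := by
    intro t ht j
    refine le_trans ?_ (integral_loss_le_linearized_regret hd H hε hεR hu ht j hzr)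
    have hc := continuous_of_convexOn (H.loss_convex t ht j)
    have := integral_mono (μ := μ) (integrable_const (-(2 * G * R)))
      (integrable_comp_trajectory (σ := σ) H hεR hu ht j
      (f := fun x => max (P.loss t j x - P.loss t j z - 2 * G * ε) (-(2 * G * R))) (by fun_prop))
      fun ω => le_max_right _ _
    simpa using this
  have hWsum : -(2 * G * R * N * T) ≤ ∑ t ∈ Icc 1 T, ∑ j, ∫ ω, W t j ω ∂μ := by
    refine le_trans (le_of_eq ?_) (sum_le_sum fun t ht => sum_le_sum fun j _ => hWlow t ht j)
    simp only [sum_const, card_univ, Fintype.card_fin, nsmul_eq_mul, Nat.card_Icc,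
      Nat.add_sub_cancel]
    ring
  set Hs := ∑ t ∈ Icc 1 T, 1 / (t : ℝ)
  have hpath : ∀ᵐ ω ∂μ,
      ∑ t ∈ Icc 1 T, ∑ i, ∑ s, max (P.con s ((trajectory P R G σ ε (u ω) t).1 i)) 0
        + θ * (2 * p * G ^ 2 / σ) * ∑ t ∈ Icc 1 T, ∑ j, W t j ω
      ≤ θ * (2 * p * G ^ 2 / σ) * (N * (d * C / ε) ^ 2 / σ * Hs) + N * p / (2 * θ) * Hs := by
    filter_upwards [ae_norm_eq_one hu] with ω hω
    have h1 := sum_linearized_regret_le hw H hε hεR hω hz hzr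
    have h2 := sum_violation_le (ε := ε) H (u ω) hθ
    have h3 := mul_le_mul_of_nonneg_left h1 (by positivity : 0 ≤ θ * (2 * p * G ^ 2 / σ))
    have e : ∀ Q : ℝ, θ * (2 * p * G ^ 2 / σ) * (σ / (4 * p * G ^ 2) * Q) = θ / 2 * Q := by
      intro Q
      field_simp
      ring
    rw [mul_add, e] at h3
    linarith
  have hci := fun t (ht : t ∈ Icc 1 T) i s => integrable_violation (ε := ε) H hεR hu ht i s
  have hWs : Integrable (fun ω => ∑ t ∈ Icc 1 T, ∑ j, W t j ω) μ :=
    integrable_finsetSum _ fun t ht => integrable_finsetSum _ fun j _ => hWi t ht j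
  have hcs : Integrable (fun ω =>
      ∑ t ∈ Icc 1 T, ∑ i, ∑ s, max (P.con s ((trajectory P R G σ ε (u ω) t).1 i)) 0) μ :=
    integrable_finsetSum _ fun t ht => integrable_finsetSum _ fun i _ =>
      integrable_finsetSum _ fun s _ => hci t ht i s
  have h_int := integral_mono_ae (hcs.add (hWs.const_mul (θ * (2 * p * G ^ 2 / σ))))
    (integrable_const _) hpath
  have e1 : ∫ ω, (∑ t ∈ Icc 1 T, ∑ j, W t j ω) ∂μ = ∑ t ∈ Icc 1 T, ∑ j, ∫ ω, W t j ω ∂μ := by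
    rw [integral_finsetSum _ fun t ht => integrable_finsetSum _ fun j _ => hWi t ht j]
    exact sum_congr rfl fun t ht => integral_finsetSum _ fun j _ => hWi t ht j
  have e2 : ∫ ω, (∑ t ∈ Icc 1 T, ∑ i, ∑ s,
        max (P.con s ((trajectory P R G σ ε (u ω) t).1 i)) 0) ∂μ
      = ∑ t ∈ Icc 1 T, ∑ i, ∑ s,
        ∫ ω, max (P.con s ((trajectory P R G σ ε (u ω) t).1 i)) 0 ∂μ := by
    rw [integral_finsetSum _ fun t ht => integrable_finsetSum _ fun i _ =>
      integrable_finsetSum _ fun s _ => hci t ht i s]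
    refine sum_congr rfl fun t ht => ?_
    rw [integral_finsetSum _ fun i _ => integrable_finsetSum _ fun s _ => hci t ht i s]
    exact sum_congr rfl fun i _ => integral_finsetSum _ fun s _ => hci t ht i s
  simp only [Pi.add_apply] at h_int
  rw [integral_add hcs (hWs.const_mul _), integral_const_mul, e1, e2, integral_const,
    probReal_univ, one_smul] at h_int
  have h5 := mul_le_mul_of_nonneg_left hWsum (by positivity : 0 ≤ θ * (2 * p * G ^ 2 / σ))
  linarith

end

end DOCO

/-! ### Parameter choice and constants -/

namespace DOCO

open Finset

theorem sum_one_div_le (T : ℕ) : ∑ t ∈ Icc 1 T, 1 / (t : ℝ) ≤ 1 + Real.log T := by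
  have h := harmonic_le_one_add_log T
  rw [harmonic_eq_sum_Icc] at h
  push_cast at h
  simpa using h

theorem one_le_log {T : ℕ} (hT : 3 ≤ T) : 1 ≤ Real.log T := by
  have hT' : (3 : ℝ) ≤ T := by exact_mod_cast hT
  rw [Real.le_log_iff_exp_le (by linarith)]
  linarith [Real.exp_one_lt_d9]

/-- Makes the variance term of the violation bound of order `T` without a logarithm. -/
theorem one_add_log_le {T : ℕ} (hT : 3 ≤ T) :
    1 + Real.log T ≤ 2 * (T : ℝ) ^ ((1 : ℝ) / 3) := by
  have hT' : (3 : ℝ) ≤ T := by exact_mod_cast hT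
  have hL := one_le_log hT
  rw [Real.rpow_def_of_pos (by linarith)]
  have := Real.quadratic_le_exp_of_nonneg (x := Real.log T * (1 / 3)) (by positivity)
  nlinarith [sq_nonneg (Real.log T - 3 / 2)]

/-- Positivity of `p` and `G` is forced: without constraints `𝓧` would be unbounded, and adding the
strong convexity inequalities between `0` and a point of norm `R` gives `σR² ≤ 2 G_ℓ R`. -/
theorem Problem.regular {d N p T : ℕ} {P : Problem d N p} {R Gl Gc σ C : ℝ} (hd : 1 ≤ d)
    (hN : 1 ≤ N) (hT : 1 ≤ T) (hball : P.ContainedInBall R) (hzero : (0 : Vec d) ∈ P.feasible)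
    (hgrad : P.ConvexBoundedGradients T R Gl Gc) (hstrong : P.StronglyConvexLosses T R σ)
    (hbound : P.BoundedLosses T R C) : P.Regular T R (max Gl Gc) σ C := by
  have := nontrivial_vec hd
  obtain ⟨hR, hsub⟩ := hball
  have hp : 1 ≤ p := by
    by_contra hp
    obtain rfl : p = 0 := by omega
    obtain ⟨x, hx⟩ := NormedSpace.exists_lt_norm ℝ (Vec d) R
    have := hsub (show x ∈ P.feasible from fun s => s.elim0)
    rw [mem_closedBall_zero_iff] at this
    linarith
  have hGl : 0 < Gl := by
    obtain ⟨x, hx⟩ := exists_norm_eq (Vec d) hR.le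
    have ht : 1 ∈ Icc 1 T := mem_Icc.2 ⟨le_rfl, hT⟩
    have hx0 : (0 : Vec d) ∈ Ball d R := by simpa using hR.le
    have hxR : x ∈ Ball d R := by simpa using hx.le
    have h1 := hstrong.2 1 ht ⟨0, hN⟩ x hxR 0 hx0
    have h2 := hstrong.2 1 ht ⟨0, hN⟩ 0 hx0 x hxR
    have h3 := abs_real_inner_le_norm (gradient (P.loss 1 ⟨0, hN⟩) 0) x
    have h4 := abs_real_inner_le_norm (gradient (P.loss 1 ⟨0, hN⟩) x) x
    rw [sub_zero] at h1
    rw [zero_sub, norm_neg, inner_neg_right] at h2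
    have h5 := ((hgrad.1 1 ht ⟨0, hN⟩).2 0 hx0).2
    have h6 := ((hgrad.1 1 ht ⟨0, hN⟩).2 x hxR).2
    rw [hx] at h1 h2 h3 h4
    have h7 := mul_le_mul_of_nonneg_right h5 hR.le
    have h8 := mul_le_mul_of_nonneg_right h6 hR.le
    have h9 : 0 < σ * R ^ 2 := mul_pos hstrong.1 (by positivity)
    have h10 := (abs_le.1 h3).1
    have h11 := (abs_le.1 h4).2
    have h12 : 0 < 2 * Gl * R := by linarith
    exact (mul_pos_iff_of_pos_right hR).1 (by linarith : 0 < Gl * R)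
  exact
    { p_pos := hp
      G_pos := lt_max_of_lt_left hGl
      σ_pos := hstrong.1
      loss_convex := fun t ht i => (hgrad.1 t ht i).1
      loss_grad := fun t ht i x hx =>
        ⟨((hgrad.1 t ht i).2 x hx).1, ((hgrad.1 t ht i).2 x hx).2.trans (le_max_left _ _)⟩
      loss_strong := hstrong.2
      loss_bound := hbound
      con_convex := fun s => (hgrad.2 s).1
      con_grad := fun s x hx =>
        ⟨((hgrad.2 s).2 x hx).1, ((hgrad.2 s).2 x hx).2.trans (le_max_right _ _)⟩
      con_zero := hzero }

/-- Shrinking a feasible point towards the origin keeps it feasible. -/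
theorem Problem.Regular.smul_mem_feasible {d N p T : ℕ} {P : Problem d N p} {R G σ C : ℝ}
    (H : P.Regular T R G σ C) {x : Vec d} (hx : x ∈ P.feasible) {a : ℝ} (ha : 0 ≤ a)
    (ha1 : a ≤ 1) : a • x ∈ P.feasible := by
  intro s
  have h := (H.con_convex s).2 (Set.mem_univ x) (Set.mem_univ 0) ha (sub_nonneg.2 ha1)
    (add_sub_cancel _ _)
  simp only [smul_zero, add_zero, smul_eq_mul] at h
  have h1 := mul_nonpos_of_nonneg_of_nonpos ha (hx s)
  have h2 := mul_nonpos_of_nonneg_of_nonpos (sub_nonneg.2 ha1) (H.con_zero s)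
  linarith

/-- With `τ = T^{1/3} = 1/ε`, both the variance `ε⁻²` and the bias `εT` equal `τ²`; lower powers of
`τ` are raised to `τ²`. -/
theorem regret_arith {N d G K C σ τ L S : ℝ} (hN : 0 ≤ N) (hd : 0 ≤ d) (hG : 0 ≤ G) (hK : 0 ≤ K)
    (hC : 0 ≤ C) (hσ : 0 < σ) (hτ : 1 ≤ τ) (hL : 1 ≤ L) (hS : S ≤ 2 * L) :
    (N * (d * C / (1 / τ)) ^ 2 / σ + G * K * N * (d * C / (1 / τ)) / σ
        + N * K ^ 2 * G ^ 2 / (4 * σ)) * S + 3 * N * G * (1 / τ) * τ ^ 3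
      ≤ (3 * N * G + N / (2 * σ) * (4 * C * K * G * d + 4 * C ^ 2 * d ^ 2 + K ^ 2 * G ^ 2))
        * τ ^ 2 * L := by
  have hτ0 : 0 < τ := by linarith
  have h1 : τ ≤ τ ^ 2 := by nlinarith
  have h2 : 1 ≤ τ ^ 2 := by nlinarith
  calc _ ≤ (N * (d * C / (1 / τ)) ^ 2 / σ + G * K * N * (d * C / (1 / τ)) / σ
        + N * K ^ 2 * G ^ 2 / (4 * σ)) * (2 * L) + 3 * N * G * (1 / τ) * τ ^ 3 := by gcongr
    _ = (N * (d * C) ^ 2 / σ * τ ^ 2 + G * K * N * (d * C) / σ * τ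
        + N * K ^ 2 * G ^ 2 / (4 * σ) * 1) * (2 * L) + 3 * N * G * τ ^ 2 * 1 := by
        field_simp
    _ ≤ (N * (d * C) ^ 2 / σ * τ ^ 2 + G * K * N * (d * C) / σ * τ ^ 2
        + N * K ^ 2 * G ^ 2 / (4 * σ) * τ ^ 2) * (2 * L) + 3 * N * G * τ ^ 2 * L := by gcongr
    _ = _ := by field_simp; ring

theorem violation_arith {N d p G R C σ τ L S : ℝ} (hN : 0 ≤ N) (hd : 0 ≤ d) (hp : 0 ≤ p)
    (hG : 0 < G) (hR : 0 < R) (hC : 0 ≤ C) (hσ : 0 < σ) (hτ : 1 ≤ τ) (hL : 1 ≤ L)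
    (hS : S ≤ 2 * L) (hS' : S ≤ 2 * τ) :
    ∃ θ : ℝ, 0 < θ ∧ θ * (2 * p * G ^ 2 / σ) * (N * (d * C / (1 / τ)) ^ 2 / σ * S
          + 2 * G * R * N * τ ^ 3) + N * p / (2 * θ) * S
      ≤ 4 * p * N * G / √σ * (√(G * R) + C * d / √σ) * √(τ ^ 3 * L) := by
  have hτ0 : 0 < τ := by linarith
  have hL0 : 0 < L := by linarith
  obtain ⟨w, hw, hwσ⟩ : ∃ w, 0 < w ∧ σ = w ^ 2 :=
    ⟨√σ, Real.sqrt_pos.2 hσ, (Real.sq_sqrt hσ.le).symm⟩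
  obtain ⟨g, hg, hgr⟩ : ∃ g, 0 < g ∧ G * R = g ^ 2 :=
    ⟨√(G * R), Real.sqrt_pos.2 (by positivity), (Real.sq_sqrt (by positivity)).symm⟩
  obtain ⟨a, ha, haτ⟩ : ∃ a, 0 < a ∧ τ ^ 3 = a ^ 2 :=
    ⟨√(τ ^ 3), Real.sqrt_pos.2 (by positivity), (Real.sq_sqrt (by positivity)).symm⟩
  obtain ⟨l, hl, hlL⟩ : ∃ l, 0 < l ∧ L = l ^ 2 :=
    ⟨√L, Real.sqrt_pos.2 hL0, (Real.sq_sqrt hL0.le).symm⟩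
  have e1 : √σ = w := by rw [hwσ, Real.sqrt_sq hw.le]
  have e2 : √(G * R) = g := by rw [hgr, Real.sqrt_sq hg.le]
  have e3 : √(τ ^ 3 * L) = a * l := by
    rw [haτ, hlL, ← mul_pow, Real.sqrt_sq (by positivity)]
  rw [e1, e2, e3]
  set s := g + C * d / w with hs
  have hCd : 0 ≤ C * d / w := by positivity
  have hs0 : 0 < s := by positivity
  -- The minimizer of `θA + B/θ` for `A = 4pNG²a²s²/σ` and `B = Np l²`, the bounds obtained from `S
  -- ≤ 2τ` in the variance term and `S ≤ 2L` in the last term. The minimum `2√(AB)` is exactly the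
  -- stated constant.
  refine ⟨w * l / (2 * G * s * a), by positivity, ?_⟩
  have hbr : N * (d * C / (1 / τ)) ^ 2 / σ * S + 2 * G * R * N * τ ^ 3
      ≤ 2 * N * a ^ 2 * s ^ 2 := by
    calc _ ≤ N * (d * C / (1 / τ)) ^ 2 / σ * (2 * τ) + 2 * G * R * N * τ ^ 3 := by gcongr
      _ = 2 * N * τ ^ 3 * ((C * d / w) ^ 2 + G * R) := by rw [hwσ]; field_simp
      _ = 2 * N * a ^ 2 * ((C * d / w) ^ 2 + g ^ 2) := by rw [hgr, haτ]
      _ ≤ 2 * N * a ^ 2 * s ^ 2 := by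
        gcongr
        nlinarith [mul_nonneg hg.le hCd]
  calc _ ≤ w * l / (2 * G * s * a) * (2 * p * G ^ 2 / σ) * (2 * N * a ^ 2 * s ^ 2)
        + N * p / (2 * (w * l / (2 * G * s * a))) * (2 * L) := by gcongr
    _ = _ := by
      rw [hlL, hwσ]
      field_simp
      ring

end DOCO

/-! ### The theorem -/

theorem theorem4 {d N p : ℕ} (hd : 1 ≤ d) (hN : 1 ≤ N) (P : DOCO.Problem d N p)
    (T B : ℕ) (hT : 3 ≤ T) (R Gl Gc G ζ σ C : ℝ) (hG : G = max Gl Gc)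
    (hball : P.ContainedInBall R)
    (hzero : (0 : DOCO.Vec d) ∈ P.feasible)
    (hgrad : P.ConvexBoundedGradients T R Gl Gc)
    (hconn : P.JointlyConnected B)
    (hweight : P.CompatibleWeights ζ)
    (hstrong : P.StronglyConvexLosses T R σ)
    (hbound : P.BoundedLosses T R C)
    (hshrink : 1 / (R * (T : ℝ) ^ ((1 : ℝ) / 3)) ≤ 1)
    (xstar : DOCO.Vec d) (hxstar : P.IsBestDecision T xstar)
    {Ω : Type*} [MeasurableSpace Ω] (μ : MeasureTheory.Measure Ω)
    [MeasureTheory.IsProbabilityMeasure μ]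
    (u : Ω → ℕ → Fin N → DOCO.Vec d) (hu : DOCO.IsExploration μ T u) :
    (∀ i, MeasureTheory.Integrable
      (fun ω => DOCO.regret P T xstar (DOCO.decision P T R G σ (u ω)) i) μ) ∧
    (∀ t ∈ Finset.Icc 1 T, ∀ i s, MeasureTheory.Integrable
      (fun ω => max (P.con s (DOCO.decision P T R G σ (u ω) t i)) 0) μ) ∧
    DOCO.expectedSystemRegret μ P T xstar (fun ω => DOCO.decision P T R G σ (u ω))
      ≤ DOCO.regretConst d N B ζ G C σ * (T : ℝ) ^ ((2 : ℝ) / 3) * Real.log T ∧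
    DOCO.expectedViolation μ P T (fun ω => DOCO.decision P T R G σ (u ω))
      ≤ DOCO.violationConst d N p R G C σ * √(T * Real.log T) := by
  have H := DOCO.Problem.regular hd hN (by omega) hball hzero hgrad hstrong hbound
  rw [← hG] at H
  have hR := hball.1
  have hσ := H.σ_pos
  have hGp := H.G_pos
  have hTR : (0 : ℝ) < T := by
    have : 0 < T := by omega
    exact_mod_cast this
  set τ : ℝ := (T : ℝ) ^ ((1 : ℝ) / 3) with hτdef
  have hτ3 : τ ^ 3 = T := by
    rw [hτdef, ← Real.rpow_natCast, ← Real.rpow_mul hTR.le]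
    norm_num
  have hτ2 : (T : ℝ) ^ ((2 : ℝ) / 3) = τ ^ 2 := by
    rw [hτdef, ← Real.rpow_natCast, ← Real.rpow_mul hTR.le]
    norm_num
  have hτ1 : 1 ≤ τ := Real.one_le_rpow (by exact_mod_cast (by omega : 1 ≤ T)) (by norm_num)
  have hτ0 : 0 < τ := by linarith
  have hε : 0 < 1 / τ := by positivity
  have hπ : 1 / (R * τ) * R = 1 / τ := by field_simp
  have hεR : 1 / τ ≤ R := by
    rw [← hπ]
    exact mul_le_of_le_one_left hR.le hshrink
  have hdec : ∀ v t i, DOCO.decision P T R G σ v t i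
      = (DOCO.trajectory P R G σ (1 / τ) v t).1 i := by
    intro v t i
    unfold DOCO.decision DOCO.trajectory
    rw [← hτdef, sub_mul, hπ, one_mul]
  have hxR : ‖xstar‖ ≤ R := by simpa using hball.2 hxstar.1
  -- The shrunk optimum serves as comparator in both bounds, because projection onto the smaller
  -- ball is nonexpansive only towards points of that ball.
  set z := (1 - 1 / (R * τ)) • xstar with hz
  have hπ0 : 0 ≤ 1 / (R * τ) := by positivity
  have hzf : z ∈ P.feasible :=
    H.smul_mem_feasible hxstar.1 (sub_nonneg.2 hshrink) (by linarith)
  have hzr : ‖z‖ ≤ R - 1 / τ := by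
    rw [hz, norm_smul, Real.norm_of_nonneg (sub_nonneg.2 hshrink), ← hπ]
    nlinarith
  have hzx : ‖z - xstar‖ ≤ 1 / τ := by
    have : z - xstar = -((1 / (R * τ)) • xstar) := by rw [hz, sub_smul, one_smul]; abel
    rw [this, norm_neg, norm_smul, Real.norm_of_nonneg hπ0, ← hπ]
    gcongr
  have hC : 0 ≤ C := (abs_nonneg _).trans
    (hbound 1 (Finset.mem_Icc.2 ⟨le_rfl, by omega⟩) ⟨0, hN⟩ 0 (by simpa using hR.le))
  have hL := DOCO.one_le_log hT
  have hS1 := DOCO.sum_one_div_le T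
  have hS2 := hS1.trans (DOCO.one_add_log_le hT)
  have hreg : ∀ ω i, DOCO.regret P T xstar (DOCO.decision P T R G σ (u ω)) i
      = DOCO.regret P T xstar (fun t i => (DOCO.trajectory P R G σ (1 / τ) (u ω) t).1 i) i := by
    intro ω i
    simp only [DOCO.regret, hdec]
  refine ⟨fun i => ?_, fun t ht i s => ?_, ?_, ?_⟩
  · simp only [hreg]
    exact DOCO.integrable_regret H hεR hu xstar i
  · simp only [hdec]
    exact DOCO.integrable_violation H hεR hu ht i s
  · have : Nonempty (Fin N) := ⟨⟨0, hN⟩⟩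
    refine ciSup_le fun i => ?_
    simp only [hreg]
    refine (DOCO.integral_regret_le hd hconn hweight H hε hεR hu i hzf hzr hzx).trans ?_
    rw [hτ2, ← hτ3]
    exact DOCO.regret_arith (Nat.cast_nonneg N) (Nat.cast_nonneg d) hGp.le
      (DOCO.cHat_nonneg hconn hweight i) hC hσ hτ1 (by rw [hτ3]; exact hL)
      (by rw [hτ3]; linarith)
  · obtain ⟨θ, hθ, hle⟩ := DOCO.violation_arith (Nat.cast_nonneg N) (Nat.cast_nonneg d)
      (Nat.cast_nonneg p) hGp hR hC hσ hτ1 hL (by linarith) hS2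
    simp only [DOCO.expectedViolation, hdec]
    refine (DOCO.sum_integral_violation_le hd (fun t ht => (hweight.2 t ht).1) H hε hεR hu hzf hzr
      hθ).trans ?_
    rw [hτ3] at hle
    exact hle
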